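/- **Setting.** Let $\mathcal V$ be a unitary vertex operator algebra. A *unitary module* $A$ of $\mathcal V$ is a module with an $\mathbb N_0$-grading $A=\bigoplus_{n\ge 0}A_n$ by levels, generated by its top level $A_0$ (as is every finite direct sum of irreducible modules in which each summand starts at level $0$), and with an invariant inner product. It is the direct sum of the spaces $A_{n,\alpha}=\{a\in A_n : L_0a=(\alpha+n)a\}$, where $\alpha$ ranges over a finite set $I_A\subset\mathbb C$; $I_A$ denotes the set of those $\alpha$ that occur, and $|I_A|$ its cardinality. Operator norms refer to the Hilbert space completions. Let $\mathcal Y(a,x)=\sum_s a_{(s)}x^{-s-1}$, $a_{(s)}\in\mathrm{Hom}(B,C)$, be an intertwining operator of type $\binom{C}{A\,B}$ between unitary modules. For $z\in\mathbb C\setminus\{0\}$ (powers of $z$ by the principal branch) and $0<q<1$ let $$W_q(a,z)b=q^{L_0/2}\,\mathcal Y(q^{L_0/2}a,z)\,q^{L_0/2}b .$$ For a linear subspace $S\subset A$, $\mathcal Y$ is *$S$-bounded* with boundedness parameter $\vartheta\ge 0$ if, for all $z\neq0$ and $0<q<\min\{|z|^2,|z|^{-2}\}$, the series $W_q(a,z)b$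 converges and $\|W_q(a,z)b\|\le\vartheta(q,z)\|a\|\|b\|$ for all $a\in S$, $b\in B$. Put $S_{\mathsf{hom}}=\bigoplus_{n,\alpha}(S\cap A_{n,\alpha})$. For $a\in A_{r,\alpha}$, $\tau\in I=\{\alpha+\beta-\gamma:\alpha\in I_A,\beta\in I_B,\gamma\in I_C\}$ and $m\in\mathbb Z$, let $\mathsf y(a)_{\tau,m}$ be the part of the coefficient of $x^{-m-\tau-r}$ in $\mathcal Y(a,x)$ that maps each $B_{k,\beta}$ to $C_{k-m,\alpha+\beta-\tau}$. For $N\ge0$ the *truncated* operators are $$\mathcal Y^{[N]}(a,z)=\sum_{\tau\in I}\ \sum_{m\in\mathbb Z,\,|m|\le N}\mathsf y(a)_{\tau,m}\,z^{-m-\tau-r}\qquad(a\in A_{r,\alpha}),$$ extended linearly in $a$, and $W_q^{[N]}(a,z)b=q^{L_0/2}\,\mathcal Y^{[N]}(q^{L_0/2}a,z)\,q^{L_0/2}b$. **Lemma.** There is a constant $\kappa(A,B,C)>0$ for every three unitary modules $A,B,C$ of $\mathcal V$, depending only on these modules, such that the following holds. Let $n\ge1$, let $A^{(1)},\dots,A^{(n)}$,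 $B^{(0)},\dots,B^{(n)}$ be unitary modules, and for $j=1,\dots,n$ let $\mathcal Y_j$ be an $S^{(j)}$-bounded intertwining operator of type $\binom{B^{(j-1)}}{A^{(j)}\,B^{(j)}}$ with boundedness parameter $\vartheta_j$. Let $a_j\in S^{(j)}_{\mathsf{hom}}$, $N\ge0$, $z\in\mathbb C\setminus\{0\}$ and $q>0$ with $\sqrt q<\min\{|z|^2,|z|^{-2}\}$, and let $W_j$, $W_j^{[N]}$ be the scaled and truncated scaled intertwiners of $\mathcal Y_j$ with parameter $q$. Then all $W_j(a_j,z)$ and $W_j^{[N]}(a_j,z)$ extend to bounded operators from (the completion of) $B^{(j)}$ to that of $B^{(j-1)}$, and the transfer operators $$T=W_1(a_1,z)\circ\cdots\circ W_n(a_n,z),\qquad T^{[N]}=W_1^{[N]}(a_1,z)\circ\cdots\circ W_n^{[N]}(a_n,z)$$ satisfy $$\|T-T^{[N]}\|\le q^{N/4}\cdot n\,\kappa\,\Bigl(\max_{1\le j\le n}\frac{\sqrt{|I_{B^{(j)}}|}\;\vartheta_j(\sqrt q,z)}{1-\sqrt q}\Bigr)^{n}\cdot\prod_{i=1}^n\|a_i\|_{A^{(i)}},\qquad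 \kappa=\max_{1\le j\le n}\kappa(A^{(j)},B^{(j)},B^{(j-1)}).$$ -/

import Mathlib

open scoped ComplexConjugate InnerProductSpace

universe u

noncomputable section

/-! ### Vertex operator algebras, modules, intertwiners -/

/-- The Jacobi identity in component (Borcherds) form for a family of modes
`I a s : B → C`, where `Y(a, x) = ∑ₛ I a s x^(-s-1)` and `YA, YB, YC` are the modes `v ↦ vₙ` of the
vertex operators on `A`, `B`, `C`.  The index `s` runs over `R = ℤ` for vertex operators and over
`R = ℂ` for intertwiners.  All sums are finite whenever the modes are lower truncated. -/
def JacobiIdentity {V A B C R : Type*} [AddCommGroup C] [AddGroupWithOne R]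
    (YA : V → ℤ → A → A) (YB : V → ℤ → B → B) (YC : V → ℤ → C → C) (I : A → R → B → C) : Prop :=
  ∀ (v : V) (a : A) (b : B) (l m : ℤ) (s : R),
    ∑ᶠ i : ℕ, Ring.choose m i • I (YA v (l + i) a) ((m : R) + s - (i : R)) b =
      ∑ᶠ i : ℕ, ((-1) ^ i * Ring.choose l i) •
        (YC v (m + l - i) (I a (s + (i : R)) b)
          - (l.negOnePow : ℤ) • I a (s + (l : R) - (i : R)) (YB v (m + i) b))

/-- A vertex operator algebra structure on a complex vector space `V`.  The mode `vₙ` is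
`VertexOperator.ncoeff (Y v) n`, i.e. `Y(v, x) = ∑ₙ vₙ x^(-n-1)`; that `vₙ u = 0` for large `n` is
part of Mathlib's `VertexOperator`. -/
structure VOA (V : Type u) [AddCommGroup V] [Module ℂ V] where
  Y : V →ₗ[ℂ] VertexOperator ℂ V
  vac : V
  ω : V
  /-- central charge -/
  c : ℂ
  level : ℕ → Submodule ℂ V
  level_internal : DirectSum.IsInternal level
  finite_level : ∀ n, FiniteDimensional ℂ (level n)
  vac_mem : vac ∈ level 0
  ω_mem : ω ∈ level 2
  vacuum : ∀ (n : ℤ) (v : V), VertexOperator.ncoeff (Y vac) n v = if n = -1 then v else 0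
  creation : ∀ v : V, VertexOperator.ncoeff (Y v) (-1) vac = v
  creation_nonneg : ∀ (v : V) (n : ℤ), 0 ≤ n → VertexOperator.ncoeff (Y v) n vac = 0
  /-- `Vₙ` is the eigenspace of `L₀ = ω₁` with eigenvalue `n`. -/
  level_eq : ∀ n : ℕ, level n = Module.End.eigenspace (VertexOperator.ncoeff (Y ω) 1) (n : ℂ)
  /-- Virasoro relations for `Lₙ = ω_{n+1}`. -/
  virasoro : ∀ (m n : ℤ) (v : V),
    VertexOperator.ncoeff (Y ω) (m + 1) (VertexOperator.ncoeff (Y ω) (n + 1) v)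
      - VertexOperator.ncoeff (Y ω) (n + 1) (VertexOperator.ncoeff (Y ω) (m + 1) v) =
    ((m : ℂ) - n) • VertexOperator.ncoeff (Y ω) (m + n + 1) v
      + (if m + n = 0 then c / 12 * m * ((m : ℂ) ^ 2 - 1) else 0) • v
  /-- `d/dx Y(v, x) = Y(L₋₁ v, x)`. -/
  translation : ∀ (v : V) (n : ℤ),
    VertexOperator.ncoeff (Y (VertexOperator.ncoeff (Y ω) 0 v)) n =
      (-(n : ℂ)) • VertexOperator.ncoeff (Y v) (n - 1)
  jacobi : JacobiIdentity (R := ℤ)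
    (fun v n u => VertexOperator.ncoeff (Y v) n u) (fun v n u => VertexOperator.ncoeff (Y v) n u)
    (fun v n u => VertexOperator.ncoeff (Y v) n u) (fun v n u => VertexOperator.ncoeff (Y v) n u)

/-- An (`ℕ₀`-gradable) module `A` of a vertex operator algebra.  The levels `Aₙ` are indexed by `ℤ`
with the convention `Aₙ = 0` for `n < 0`.  The top level `A₀` generates `A`: this fixes the grading
of a direct sum of irreducible modules so that each summand starts at level `0`. -/
structure VOAModule {V : Type u} [AddCommGroup V] [Module ℂ V] (𝒱 : VOA V)
    (A : Type u) [AddCommGroup A] [Module ℂ A] where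
  Y : V →ₗ[ℂ] VertexOperator ℂ A
  level : ℤ → Submodule ℂ A
  level_neg : ∀ n, n < 0 → level n = ⊥
  level_internal : DirectSum.IsInternal level
  vacuum : ∀ (n : ℤ) (a : A), VertexOperator.ncoeff (Y 𝒱.vac) n a = if n = -1 then a else 0
  virasoro : ∀ (m n : ℤ) (a : A),
    VertexOperator.ncoeff (Y 𝒱.ω) (m + 1) (VertexOperator.ncoeff (Y 𝒱.ω) (n + 1) a)
      - VertexOperator.ncoeff (Y 𝒱.ω) (n + 1) (VertexOperator.ncoeff (Y 𝒱.ω) (m + 1) a) =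
    ((m : ℂ) - n) • VertexOperator.ncoeff (Y 𝒱.ω) (m + n + 1) a
      + (if m + n = 0 then 𝒱.c / 12 * m * ((m : ℂ) ^ 2 - 1) else 0) • a
  translation : ∀ (v : V) (n : ℤ),
    VertexOperator.ncoeff (Y (VertexOperator.ncoeff (𝒱.Y 𝒱.ω) 0 v)) n =
      (-(n : ℂ)) • VertexOperator.ncoeff (Y v) (n - 1)
  jacobi : JacobiIdentity (R := ℤ)
    (fun v n u => VertexOperator.ncoeff (𝒱.Y v) n u) (fun v n a => VertexOperator.ncoeff (Y v) n a)
    (fun v n a => VertexOperator.ncoeff (Y v) n a) (fun v n a => VertexOperator.ncoeff (Y v) n a)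
  /-- A mode `vₘ` of `v ∈ V_w` raises the level by `w - m - 1`. -/
  mode_level : ∀ (w : ℕ) (v : V), v ∈ 𝒱.level w → ∀ (n m : ℤ) (a : A), a ∈ level n →
    VertexOperator.ncoeff (Y v) m a ∈ level (n + w - m - 1)
  /-- `A` is the direct sum of the weight spaces
  `A_{n,α} = {a ∈ Aₙ | L₀ a = (α + n) a}`. -/
  weight_internal : DirectSum.IsInternal (fun p : ℤ × ℂ =>
    level p.1 ⊓ Module.End.eigenspace (VertexOperator.ncoeff (Y 𝒱.ω) 1) (p.2 + p.1))
  /-- Only finitely many `α` occur. -/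
  finite_weights : {α : ℂ | ∃ n : ℤ,
    level n ⊓ Module.End.eigenspace (VertexOperator.ncoeff (Y 𝒱.ω) 1) (α + n) ≠ ⊥}.Finite
  top_generates : ∀ n : ℤ, level n ≤ Submodule.span ℂ
    {x : A | ∃ (w : ℕ) (v : V) (a : A), v ∈ 𝒱.level w ∧ a ∈ level 0 ∧
      x = VertexOperator.ncoeff (Y v) (w - n - 1) a}

namespace VOAModule

variable {V : Type u} [AddCommGroup V] [Module ℂ V] {𝒱 : VOA V}
  {A : Type u} [AddCommGroup A] [Module ℂ A]

/-- `A_{n,α}`, the vectors of level `n` and weight `α + n`, for `p = (n, α)`. -/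
def weightSpace (M : VOAModule 𝒱 A) (p : ℤ × ℂ) : Submodule ℂ A :=
  M.level p.1 ⊓ Module.End.eigenspace (VertexOperator.ncoeff (M.Y 𝒱.ω) 1) (p.2 + p.1)

/-- The set `I_A` of all `α` such that some `A_{n,α}` is non-zero. -/
def weights (M : VOAModule 𝒱 A) : Set ℂ := {α | ∃ n : ℤ, M.weightSpace (n, α) ≠ ⊥}

/-- The operator acting on each `A_{n,α}` as multiplication by `f (n, α)`. -/
def diag (M : VOAModule 𝒱 A) (f : ℤ × ℂ → ℂ) : A →ₗ[ℂ] A :=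
  DirectSum.toModule ℂ (ℤ × ℂ) A (fun p => f p • (M.weightSpace p).subtype) ∘ₗ
    (LinearEquiv.ofBijective (DirectSum.coeLinearMap M.weightSpace) M.weight_internal).symm

/-- The projection onto `A_{n,α}`, for `p = (n, α)`. -/
def proj (M : VOAModule 𝒱 A) (p : ℤ × ℂ) : A →ₗ[ℂ] A := M.diag (Pi.single p 1)

/-- The operator `q^{L₀/2}`. -/
def qPow (M : VOAModule 𝒱 A) (q : ℝ) : A →ₗ[ℂ] A :=
  M.diag (fun p => (q : ℂ) ^ ((p.2 + p.1) / 2))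

/-- `S_hom = ⨁_{n,α} (S ∩ A_{n,α})`. -/
def homPart (M : VOAModule 𝒱 A) (S : Submodule ℂ A) : Submodule ℂ A :=
  ⨆ p : ℤ × ℂ, S ⊓ M.weightSpace p

/-- For `v` homogeneous of weight `w`, the coefficient of `x^(-m-1)` in
`Y_A(e^{x L₁} (-x⁻²)^{L₀} v, x⁻¹)`, where `L₁ = ω₂`. -/
def oppositeMode (M : VOAModule 𝒱 A) (w : ℕ) (v : V) (m : ℤ) : A →ₗ[ℂ] A :=
  ∑ j ∈ Finset.range (w + 1), ((-1 : ℂ) ^ w / (j.factorial : ℂ)) •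
    VertexOperator.ncoeff (M.Y (((VertexOperator.ncoeff (𝒱.Y 𝒱.ω) 2) ^ j) v)) (2 * w - j - 2 - m)

end VOAModule

/-- A unitary vertex operator algebra: the inner product on `V` is antilinear in its first
argument, and `φ` is an antilinear involution.  The invariance condition
`⟨x₁, Y(e^{z L₁} (-z⁻²)^{L₀} v, z⁻¹) x₂⟩ = ⟨Y(φ v, z) x₁, x₂⟩` is written out in coefficients. -/
structure UnitaryVOA (V : Type u) [NormedAddCommGroup V] [InnerProductSpace ℂ V]
    extends VOA V where
  φ : V →ₗ⋆[ℂ] V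
  φ_φ : ∀ v, φ (φ v) = v
  φ_vac : φ vac = vac
  φ_ω : φ ω = ω
  φ_mode : ∀ (v w : V) (n : ℤ),
    φ (VertexOperator.ncoeff (Y v) n w) = VertexOperator.ncoeff (Y (φ v)) n (φ w)
  inner_φ : ∀ v w : V, ⟪φ v, φ w⟫_ℂ = conj ⟪v, w⟫_ℂ
  invariant : ∀ (w : ℕ) (v : V), v ∈ level w → ∀ (m : ℤ) (x₁ x₂ : V),
    ⟪x₁, (∑ j ∈ Finset.range (w + 1), ((-1 : ℂ) ^ w / (j.factorial : ℂ)) •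
      VertexOperator.ncoeff (Y (((VertexOperator.ncoeff (Y ω) 2) ^ j) v)) (2 * w - j - 2 - m) x₂)⟫_ℂ
      = ⟪VertexOperator.ncoeff (Y (φ v)) m x₁, x₂⟫_ℂ

/-- A unitary module of a unitary vertex operator algebra. -/
structure UnitaryModule {V : Type u} [NormedAddCommGroup V] [InnerProductSpace ℂ V]
    (𝒱 : UnitaryVOA V) where
  carrier : Type u
  [normed : NormedAddCommGroup carrier]
  [innerProd : InnerProductSpace ℂ carrier]
  str : VOAModule 𝒱.toVOA carrier
  invariant : ∀ (w : ℕ) (v : V), v ∈ 𝒱.level w → ∀ (m : ℤ) (x₁ x₂ : carrier),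
    ⟪x₁, str.oppositeMode w v m x₂⟫_ℂ = ⟪VertexOperator.ncoeff (str.Y (𝒱.φ v)) m x₁, x₂⟫_ℂ

attribute [instance] UnitaryModule.normed UnitaryModule.innerProd

instance {V : Type u} [NormedAddCommGroup V] [InnerProductSpace ℂ V] (𝒱 : UnitaryVOA V) :
    CoeSort (UnitaryModule 𝒱) (Type u) := ⟨UnitaryModule.carrier⟩

/-- The Hilbert space completion of a unitary module. -/
abbrev UnitaryModule.Hilb {V : Type u} [NormedAddCommGroup V] [InnerProductSpace ℂ V]
    {𝒱 : UnitaryVOA V} (A : UnitaryModule 𝒱) : Type u := UniformSpace.Completion A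

/-- An intertwining operator `𝒴(a, x) = ∑ₛ a₍ₛ₎ x^(-s-1)` from `A` to series with coefficients
`a₍ₛ₎ = coeff a s ∈ Hom(B, C)`; the exponents lie in finitely many classes modulo `ℤ`. -/
structure Intertwiner {V : Type u} [NormedAddCommGroup V] [InnerProductSpace ℂ V]
    {𝒱 : UnitaryVOA V} (A B C : UnitaryModule 𝒱) where
  coeff : A →ₗ[ℂ] ℂ → (B →ₗ[ℂ] C)
  exponents_finite : ∃ I : Finset ℂ, ∀ s : ℂ, (∀ τ ∈ I, ∀ m : ℤ, s ≠ τ + m) →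
    ∀ a : A, coeff a s = 0
  truncation : ∀ (a : A) (b : B) (s : ℂ), ∃ k : ℕ, ∀ n : ℕ, k ≤ n → coeff a (s + n) b = 0
  /-- `d/dx 𝒴(a, x) = 𝒴(L₋₁ a, x)`. -/
  translation : ∀ (a : A) (s : ℂ),
    coeff (VertexOperator.ncoeff (A.str.Y 𝒱.ω) 0 a) s = (-s) • coeff a (s - 1)
  jacobi : JacobiIdentity (R := ℂ)
    (fun v n x => VertexOperator.ncoeff (A.str.Y v) n x)
    (fun v n x => VertexOperator.ncoeff (B.str.Y v) n x)
    (fun v n x => VertexOperator.ncoeff (C.str.Y v) n x) (fun a s b => coeff a s b)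

namespace Intertwiner

variable {V : Type u} [NormedAddCommGroup V] [InnerProductSpace ℂ V] {𝒱 : UnitaryVOA V}
  {A B C : UnitaryModule 𝒱}

/-! ### Scaled intertwiners and boundedness -/

/-- The term with index `s` of `W_q(a, z) b = q^{L₀/2} 𝒴(q^{L₀/2} a, z) q^{L₀/2} b`, for a complex
number `z`; complex powers of `z` are taken with the principal branch. -/
def scaledTerm (Y : Intertwiner A B C) (q : ℝ) (z : ℂ) (a : A) (b : B) (s : ℂ) : C.Hilb :=
  ((z ^ (-s - 1) •
    C.str.qPow q (Y.coeff (A.str.qPow q a) s (B.str.qPow q b)) : C) : C.Hilb)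

/-- The vector `W_q(a, z) b` in the completion of `C`. -/
def scaled (Y : Intertwiner A B C) (q : ℝ) (z : ℂ) (a : A) (b : B) : C.Hilb :=
  ∑' s : ℂ, Y.scaledTerm q z a b s

/-- The form `⟨a₁ ⊗ b₁, a₂ ⊗ b₂⟩_{𝒴,q,z}`. -/
def form (Y : Intertwiner A B C) (q : ℝ) (z : ℂ) (a₁ : A) (b₁ : B) (a₂ : A) (b₂ : B) : ℂ :=
  ⟪Y.scaled q z a₁ b₁, Y.scaled q z a₂ b₂⟫_ℂ

/-- `ϑ` is a boundedness parameter showing that `𝒴` is `S`-bounded: for all `z ≠ 0` and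
`0 < q < min(|z|², |z|⁻²)` the series `W_q(a, z) b` converges and
`⟨a ⊗ b, a ⊗ b⟩_{𝒴,q,z} ≤ ϑ(q, z)² ‖a‖² ‖b‖²` for all `a ∈ S` and `b ∈ B`. -/
def IsBoundednessParameter (Y : Intertwiner A B C) (S : Submodule ℂ A) (ϑ : ℝ → ℂ → ℝ) : Prop :=
  ∀ (z : ℂ) (q : ℝ), z ≠ 0 → 0 < q → q < min (‖z‖ ^ 2) (1 / ‖z‖ ^ 2) →
    0 ≤ ϑ q z ∧ ∀ a ∈ S, ∀ b : B, Summable (Y.scaledTerm q z a b) ∧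
      (Y.form q z a b a b).re ≤ ϑ q z ^ 2 * ‖a‖ ^ 2 * ‖b‖ ^ 2

/-! ### Truncation -/

/-- The set `I^C_{AB}` of exponents `τ = α + β - γ`. -/
def exponents (_Y : Intertwiner A B C) : Set ℂ :=
  {τ | ∃ α ∈ A.str.weights, ∃ β ∈ B.str.weights, ∃ γ ∈ C.str.weights, τ = α + β - γ}

/-- The mode operator `y(a)_{τ,m}` for `a` of level `r`: the coefficient of `x^(-m-τ-r)` in
`𝒴(a, x)` contributed by the exponent `τ`, that is, for `a ∈ A_{r,α}`, its part mapping each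
`B_{k,β}` to `C_{k-m,α+β-τ}`.  (If no two elements of `I^C_{AB}` differ by a non-zero integer this
is the full coefficient of `x^(-m-τ-r)`.) -/
def mode (Y : Intertwiner A B C) (r : ℤ) (τ : ℂ) (m : ℤ) (a : A) (b : B) : C :=
  ∑ᶠ (α : ℂ) (k : ℤ) (β : ℂ), C.str.proj (k - m, α + β - τ)
    (Y.coeff (A.str.proj (r, α) a) (m + τ + r - 1) (B.str.proj (k, β) b))

/-- The truncated intertwiner `𝒴^{[N]}(a, z) b`: for `a ∈ A_r` it is
`∑_{τ ∈ I, |m| ≤ N} y(a)_{τ,m} b z^(-m-τ-r)`, and it is extended linearly in `a`. -/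
def truncated (Y : Intertwiner A B C) (N : ℝ) (z : ℂ) (a : A) (b : B) : C :=
  ∑ᶠ r : ℤ, ∑ᶠ τ ∈ Y.exponents, ∑ m ∈ Finset.Icc ⌈-N⌉ ⌊N⌋,
    z ^ (-(m : ℂ) - τ - r) • Y.mode r τ m a b

/-- `W_q^{[N]}(a, z) b = q^{L₀/2} 𝒴^{[N]}(q^{L₀/2} a, z) q^{L₀/2} b`, in the completion of `C`. -/
def scaledTruncated (Y : Intertwiner A B C) (N : ℝ) (q : ℝ) (z : ℂ) (a : A) (b : B) : C.Hilb :=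
  ((C.str.qPow q (Y.truncated N z (A.str.qPow q a) (B.str.qPow q b)) : C) : C.Hilb)

end Intertwiner

/-! ### Operators on the completions and transfer operators -/

section Operators

variable {V : Type u} [NormedAddCommGroup V] [InnerProductSpace ℂ V] {𝒱 : UnitaryVOA V}
  {B C : UnitaryModule 𝒱}

/-- `W` is the bounded operator between the completions that agrees with `f` on `B`. -/
def IsBoundedExtension (f : B → C.Hilb) (W : B.Hilb →L[ℂ] C.Hilb) : Prop :=
  ∀ b : B, W (b : B.Hilb) = f b

open scoped Classical in
/-- The unique bounded operator extending `f : B → Ĉ`, or `0` if `f` has no bounded extension. -/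
def boundedExtension (f : B → C.Hilb) : B.Hilb →L[ℂ] C.Hilb :=
  if h : ∃ W : B.Hilb →L[ℂ] C.Hilb, IsBoundedExtension f W then h.choose else 0

end Operators

/-- The composition `W₁ ∘ W₂ ∘ ⋯ ∘ Wₙ` of operators `Wᵢ : Hᵢ → Hᵢ₋₁`
(the operator `Wᵢ` is `W (i - 1)`). -/
def compositeOp : (n : ℕ) → (H : Fin (n + 1) → Type u) → [∀ i, NormedAddCommGroup (H i)] →
    [∀ i, NormedSpace ℂ (H i)] → (∀ i : Fin n, H i.succ →L[ℂ] H i.castSucc) →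
    (H (Fin.last n) →L[ℂ] H 0)
  | 0, H, _, _, _ => ContinuousLinearMap.id ℂ (H 0)
  | n + 1, H, _, _, W =>
      (W 0).comp (compositeOp n (fun i => H i.succ) (fun i => W i.succ))

section Transfer

variable {V : Type u} [NormedAddCommGroup V] [InnerProductSpace ℂ V] {𝒱 : UnitaryVOA V}
  {n : ℕ} {A : Fin n → UnitaryModule 𝒱} {B : Fin (n + 1) → UnitaryModule 𝒱}

/-- The transfer operator `W₁(a₁, z) ∘ ⋯ ∘ Wₙ(aₙ, z)`. -/
def transferOp (Y : ∀ i, Intertwiner (A i) (B i.succ) (B i.castSucc)) (q : ℝ) (z : ℂ)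
    (a : ∀ i, A i) : (B (Fin.last n)).Hilb →L[ℂ] (B 0).Hilb :=
  compositeOp n (fun i => (B i).Hilb) (fun i => boundedExtension ((Y i).scaled q z (a i)))

/-- The truncated transfer operator `W₁^{[N]}(a₁, z) ∘ ⋯ ∘ Wₙ^{[N]}(aₙ, z)`. -/
def truncatedTransferOp (Y : ∀ i, Intertwiner (A i) (B i.succ) (B i.castSucc)) (N : ℝ) (q : ℝ)
    (z : ℂ) (a : ∀ i, A i) : (B (Fin.last n)).Hilb →L[ℂ] (B 0).Hilb :=
  compositeOp n (fun i => (B i).Hilb)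
    (fun i => boundedExtension ((Y i).scaledTruncated N q z (a i)))

end Transfer

end

/-!
Two mechanisms give the estimate: the decay of `q^{L₀/4}` in the level, and the locality of the
truncation with respect to levels.

*Unitarity.* Invariance of the inner product makes `L₀` symmetric and gives the modes that create
level `n` from the top level adjoints that lower the level by `n`. Hence the spaces `A_{n,α}` are
pairwise orthogonal (`UnitaryModule.inner_weightSpace`). As `A` is generated by its top level, every
weight `α` occurs there, and `‖L₋₁x‖² = 2α‖x‖²` on the top level shows `α ≥ 0`
(`UnitaryModule.re_weight_nonneg`). So `q^{L₀/4}` acts on level `n` with norm at most `q^{n/4}`.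

*Truncation is a cut-off.* By the `L₀`-commutator, a single term of the series `W_q(a, z) b`
contributes to a given `C_{n,γ}` when `a` and `b` are homogeneous, and it is the mode with
`τ = α + β - γ` and `m = k - n`. Therefore `W_q^{[N]}(a, z) b`, for `b` of level `k`, is the part of
`W_q(a, z) b` in the levels `n` with `|n - k| ≤ N` (`Intertwiner.scaledTruncated_eq`).

*One intertwiner.* Factor `W_q(a, z) = q^{L₀/4} W_{√q}(q^{L₀/4} a, z) q^{L₀/4}`; the middle factor
is bounded by `ϑ(√q, z)‖a‖`. With `r = √q`, on level `k` the squared norms of `W`, `W^{[N]}` and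
`W - W^{[N]}` are at most `ϑ²‖a‖²` times the maximum of `r^{n+k}` over the levels `n` involved. This
is at most `r^k` for the first two. For the difference `|n - k| > N` forces
`r^{n+k} ≤ r^N (r^k + r^{k-N})`, the second term being present only for `k ≥ N`. The Cauchy–Schwarz
inequality over the orthogonal levels (`UnitaryModule.norm_le_of_level`) sums these to the
operator bounds `Intertwiner.scaled_bounds`, in which the constant `2` appears in the bound of the
difference only.

*Composition.* Telescoping `W₁⋯Wₙ - W₁^{[N]}⋯Wₙ^{[N]}` (`compositeOp_sub_le`) replaces one factor
by a difference in each of `n` terms, so `κ = 2` works for all modules.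
-/

/-! ### Operators diagonal in the weight decomposition -/

namespace VOAModule

variable {V : Type u} [AddCommGroup V] [Module ℂ V] {𝒱 : VOA V}
  {A : Type u} [AddCommGroup A] [Module ℂ A] (M : VOAModule 𝒱 A)

theorem isInternal_weightSpace : DirectSum.IsInternal M.weightSpace := M.weight_internal

theorem iSup_weightSpace : ⨆ p, M.weightSpace p = ⊤ :=
  M.isInternal_weightSpace.submodule_iSup_eq_top

theorem diag_of_mem {f : ℤ × ℂ → ℂ} {p : ℤ × ℂ} {x : A} (hx : x ∈ M.weightSpace p) :
    M.diag f x = f p • x := by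
  classical
  have h : (LinearEquiv.ofBijective (DirectSum.coeLinearMap M.weightSpace)
      M.weight_internal).symm x = DirectSum.lof ℂ (ℤ × ℂ) (fun p => M.weightSpace p) p ⟨x, hx⟩ := by
    rw [LinearEquiv.symm_apply_eq]
    exact (DirectSum.coeLinearMap_lof M.weightSpace p ⟨x, hx⟩).symm
  simp only [diag, LinearMap.comp_apply, LinearEquiv.coe_coe]
  rw [h, DirectSum.toModule_lof]
  rfl

theorem proj_of_mem {p p' : ℤ × ℂ} {x : A} (hx : x ∈ M.weightSpace p) :
    M.proj p' x = if p = p' then x else 0 := by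
  classical
  rw [proj, M.diag_of_mem hx, Pi.single_apply]
  split_ifs <;> simp

/-- Linear maps on a module agree once they agree on all `A_{n,α}`. -/
theorem linearMap_ext {X : Type*} [AddCommGroup X] [Module ℂ X] {f g : A →ₗ[ℂ] X}
    (h : ∀ p, ∀ x ∈ M.weightSpace p, f x = g x) : f = g := by
  ext x
  have hx : x ∈ ⨆ p, M.weightSpace p := by rw [M.iSup_weightSpace]; trivial
  induction hx using Submodule.iSup_induction' with
  | mem p x hx => exact h p x hx
  | zero => simp
  | add x y _ _ hx hy => simp [hx, hy]

theorem diag_diag (f g : ℤ × ℂ → ℂ) (x : A) : M.diag f (M.diag g x) = M.diag (f * g) x := by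
  have : M.diag f ∘ₗ M.diag g = M.diag (f * g) := M.linearMap_ext fun p x hx => by
    simp [M.diag_of_mem hx, smul_smul, mul_comm]
  exact LinearMap.congr_fun this x

theorem diag_one (x : A) : M.diag 1 x = x := by
  have : M.diag 1 = LinearMap.id := M.linearMap_ext fun p x hx => by simp [M.diag_of_mem hx]
  exact LinearMap.congr_fun this x

theorem diag_sub (f g : ℤ × ℂ → ℂ) (x : A) : M.diag (f - g) x = M.diag f x - M.diag g x := by
  have : M.diag (f - g) = M.diag f - M.diag g := M.linearMap_ext fun p x hx => by
    simp [M.diag_of_mem hx, sub_smul]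
  exact LinearMap.congr_fun this x

theorem diag_congr {f g : ℤ × ℂ → ℂ} (h : ∀ p, p.2 ∈ M.weights → f p = g p) :
    M.diag f = M.diag g := M.linearMap_ext fun p x hx => by
  rw [M.diag_of_mem hx, M.diag_of_mem hx]
  by_cases hp : p.2 ∈ M.weights
  · rw [h p hp]
  · have : x = 0 := by
      by_contra h0
      exact hp ⟨p.1, fun hb => h0 (by simpa [hb] using hx)⟩
    simp [this]

theorem diag_mem_weightSpace {f : ℤ × ℂ → ℂ} {p : ℤ × ℂ} {x : A} (hx : x ∈ M.weightSpace p) :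
    M.diag f x ∈ M.weightSpace p := by
  rw [M.diag_of_mem hx]
  exact Submodule.smul_mem _ _ hx

theorem proj_mem (p : ℤ × ℂ) (x : A) : M.proj p x ∈ M.weightSpace p := by
  have hx : x ∈ ⨆ p, M.weightSpace p := by rw [M.iSup_weightSpace]; trivial
  induction hx using Submodule.iSup_induction' with
  | mem p' x hx =>
    rw [M.proj_of_mem hx]
    split_ifs with h
    · exact h ▸ hx
    · exact zero_mem _
  | zero => simp
  | add x y _ _ hx hy => rw [map_add]; exact add_mem hx hy

/-- A vector has finitely many homogeneous components, and these compute all diagonal operators. -/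
theorem exists_support (x : A) : ∃ s : Finset (ℤ × ℂ), (∀ p, p ∉ s → M.proj p x = 0) ∧
    ∀ f, M.diag f x = ∑ p ∈ s, f p • M.proj p x := by
  classical
  have hx : x ∈ ⨆ p, M.weightSpace p := by rw [M.iSup_weightSpace]; trivial
  obtain ⟨d, hd, hs⟩ := (Submodule.mem_iSup_iff_exists_finsupp _ _).1 hx
  have hproj : ∀ p, M.proj p x = d p := by
    intro p
    rw [← hs, Finsupp.sum, map_sum]
    rw [Finset.sum_congr rfl fun p' _ => M.proj_of_mem (p' := p) (hd p')]
    simp +contextual [eq_comm]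
  refine ⟨d.support, fun p hp => by simpa [hproj] using hp, fun f => ?_⟩
  nth_rw 1 [← hs]
  rw [Finsupp.sum, map_sum]
  exact Finset.sum_congr rfl fun p _ => by rw [M.diag_of_mem (hd p), hproj]

theorem sum_proj {x : A} {s : Finset (ℤ × ℂ)} (hs : ∀ p, p ∉ s → M.proj p x = 0) :
    ∑ p ∈ s, M.proj p x = x := by
  classical
  obtain ⟨t, ht, hd⟩ := M.exists_support x
  have h1 : x = ∑ p ∈ t, M.proj p x := by simpa [M.diag_one] using hd 1
  have h2 : ∑ p ∈ s ∪ t, M.proj p x = ∑ p ∈ s, M.proj p x :=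
    (Finset.sum_subset Finset.subset_union_left fun p _ hp => hs p hp).symm
  have h3 : ∑ p ∈ s ∪ t, M.proj p x = ∑ p ∈ t, M.proj p x :=
    (Finset.sum_subset Finset.subset_union_right fun p _ hp => ht p hp).symm
  rw [← h2, h3, ← h1]

theorem L0_of_mem {p : ℤ × ℂ} {x : A} (hx : x ∈ M.weightSpace p) :
    VertexOperator.ncoeff (M.Y 𝒱.ω) 1 x = (p.2 + p.1) • x := by
  simpa [Module.End.mem_eigenspace_iff] using hx.2

theorem proj_eq_zero_of_L0 {c : ℂ} {x : A}
    (hx : VertexOperator.ncoeff (M.Y 𝒱.ω) 1 x = c • x) {p : ℤ × ℂ} (hp : p.2 + p.1 ≠ c) :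
    M.proj p x = 0 := by
  have h : VertexOperator.ncoeff (M.Y 𝒱.ω) 1 = M.diag fun p => p.2 + p.1 :=
    M.linearMap_ext fun p x hx => by rw [M.diag_of_mem hx, M.L0_of_mem hx]
  have h2 := congrArg (M.proj p) hx
  rw [h, map_smul, proj, M.diag_diag, mul_comm, ← M.diag_diag, ← proj,
    M.diag_of_mem (M.proj_mem p x)] at h2
  have h3 : (p.2 + p.1 - c) • M.proj p x = 0 := by rw [sub_smul, h2, sub_self]
  exact (smul_eq_zero.1 h3).resolve_left (sub_ne_zero.2 hp)

end VOAModule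

/-! ### The grading of modes by `L₀` -/

/-- The commutator formula for `v₁`: the instance `l = 0`, `m = 1` of the Jacobi identity. For `v = ω`
the mode `v₁` is `L₀`. -/
theorem JacobiIdentity.commutator {V A B C R : Type*} [AddCommGroup C] [AddCommGroupWithOne R]
    {YA : V → ℤ → A → A} {YB : V → ℤ → B → B} {YC : V → ℤ → C → C} {I : A → R → B → C}
    (h : JacobiIdentity YA YB YC I) (v : V) (a : A) (b : B) (s : R) :
    YC v 1 (I a s b) - I a s (YB v 1 b) = I (YA v 0 a) (1 + s) b + I (YA v 1 a) s b := by
  have h0 := h v a b 0 1 s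
  have hc : ∀ (n i : ℕ), Ring.choose (n : ℤ) i = (n.choose i : ℤ) := fun n i =>
    Ring.choose_natCast n i
  rw [finsum_eq_sum_of_support_subset (s := Finset.range 2),
    finsum_eq_sum_of_support_subset (s := Finset.range 1)] at h0
  · simp only [Finset.sum_range_succ, Finset.range_zero, Finset.sum_empty] at h0
    have hs : 1 + s - 1 = s := add_sub_cancel_left 1 s
    simpa [hs,
      Ring.choose_zero_right, Ring.choose_one_right, add_comm] using h0.symm
  · intro i hi
    have := hc 0 i
    simp only [Nat.cast_zero] at this
    simp only [Function.mem_support, this] at hi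
    rcases i with _ | i
    · simp
    · simp at hi
  · intro i hi
    have := hc 1 i
    simp only [Nat.cast_one] at this
    simp only [Function.mem_support, this] at hi
    rcases i with _ | _ | i
    · simp
    · simp
    · simp [Nat.choose_eq_zero_of_lt] at hi

namespace VOAModule

variable {V : Type u} [AddCommGroup V] [Module ℂ V] {𝒱 : VOA V}
  {A : Type u} [AddCommGroup A] [Module ℂ A] (M : VOAModule 𝒱 A)

theorem L0_mode {w : ℕ} {v : V} (hv : v ∈ 𝒱.level w) (m : ℤ) {c : ℂ} {x : A}
    (hx : VertexOperator.ncoeff (M.Y 𝒱.ω) 1 x = c • x) :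
    VertexOperator.ncoeff (M.Y 𝒱.ω) 1 (VertexOperator.ncoeff (M.Y v) m x) =
      (c + w - m - 1) • VertexOperator.ncoeff (M.Y v) m x := by
  have h := M.jacobi.commutator 𝒱.ω v x m
  have hv' : VertexOperator.ncoeff (𝒱.Y 𝒱.ω) 1 v = (w : ℂ) • v := by
    simpa [𝒱.level_eq, Module.End.mem_eigenspace_iff] using hv
  simp only [M.translation, hv', hx, map_smul, sub_eq_iff_eq_add] at h
  rw [h]
  simp only [Int.cast_add, Int.cast_one, LinearMap.smul_apply, Pi.smul_apply, add_sub_cancel_left]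
  module

end VOAModule

namespace VOA

variable {V : Type u} [AddCommGroup V] [Module ℂ V] (𝒱 : VOA V)

theorem L0_of_mem {w : ℕ} {v : V} (hv : v ∈ 𝒱.level w) :
    VertexOperator.ncoeff (𝒱.Y 𝒱.ω) 1 v = (w : ℂ) • v := by
  simpa [𝒱.level_eq, Module.End.mem_eigenspace_iff] using hv

/-- The conformal vector is quasi-primary: `L₁ω = L₁L₋₂𝟏 = 3L₋₁𝟏 = 0`. -/
theorem L1_omega : VertexOperator.ncoeff (𝒱.Y 𝒱.ω) 2 𝒱.ω = 0 := by
  have h := 𝒱.virasoro 1 (-2) 𝒱.vac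
  have h1 := 𝒱.creation_nonneg 𝒱.ω 2 (by norm_num)
  have h0 := 𝒱.creation_nonneg 𝒱.ω 0 (by norm_num)
  norm_num [h1, h0, 𝒱.creation] at h
  exact h

theorem L1_pow_mem {w : ℕ} {v : V} (hv : v ∈ 𝒱.level w) {j : ℕ} (hj : j ≤ w) :
    ((VertexOperator.ncoeff (𝒱.Y 𝒱.ω) 2) ^ j) v ∈ 𝒱.level (w - j) := by
  induction j with
  | zero => simpa using hv
  | succ j ih =>
    have h := 𝒱.L0_of_mem (ih (by omega))
    rw [pow_succ', Module.End.mul_apply, 𝒱.level_eq, Module.End.mem_eigenspace_iff]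
    set y := ((VertexOperator.ncoeff (𝒱.Y 𝒱.ω) 2) ^ j) v
    have h2 := 𝒱.virasoro 0 1 y
    norm_num [h] at h2
    rw [sub_eq_iff_eq_add] at h2
    rw [h2, Nat.cast_sub hj, Nat.cast_sub (by omega)]
    push_cast
    module

end VOA

/-! ### Orthogonality and positivity of weights -/

theorem UnitaryVOA.φ_mem_level {V : Type u} [NormedAddCommGroup V] [InnerProductSpace ℂ V]
    (𝒱 : UnitaryVOA V) {w : ℕ} {v : V} (hv : v ∈ 𝒱.level w) : 𝒱.φ v ∈ 𝒱.level w := by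
  have h := 𝒱.φ_mode 𝒱.ω v 1
  rw [𝒱.toVOA.L0_of_mem hv, 𝒱.φ_ω] at h
  rw [𝒱.level_eq, Module.End.mem_eigenspace_iff, ← h]
  simp

namespace UnitaryModule

variable {V : Type u} [NormedAddCommGroup V] [InnerProductSpace ℂ V] {𝒱 : UnitaryVOA V}
  (A : UnitaryModule 𝒱)

/-- The adjoint of `Lₙ` is `L₋ₙ`, in terms of the modes `ω_m` with `m = n + 1`. -/
theorem inner_L (m : ℤ) (x y : A) :
    ⟪VertexOperator.ncoeff (A.str.Y 𝒱.ω) m x, y⟫_ℂ =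
      ⟪x, VertexOperator.ncoeff (A.str.Y 𝒱.ω) (2 - m) y⟫_ℂ := by
  have h := A.invariant 2 𝒱.ω 𝒱.ω_mem m x y
  have h1 : ((VertexOperator.ncoeff (𝒱.Y 𝒱.ω) 2) ^ 2) 𝒱.ω = 0 := by
    rw [pow_two, Module.End.mul_apply, 𝒱.toVOA.L1_omega, map_zero]
  rw [𝒱.φ_ω] at h
  rw [← h]
  simp only [VOAModule.oppositeMode, Finset.sum_range_succ, Finset.range_zero, Finset.sum_empty,
    pow_zero, pow_one, h1, 𝒱.toVOA.L1_omega, Module.End.one_apply]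
  simp

theorem isSymmetric_L0 :
    (VertexOperator.ncoeff (A.str.Y 𝒱.ω) 1).IsSymmetric := fun x y => A.inner_L 1 x y

/-- The modes generating level `n` from level `0` have adjoints that lower the level by `n`; below
level `0` there is nothing. -/
theorem inner_eq_zero_of_level_lt {n m : ℤ} (h : m < n) {x y : A} (hx : x ∈ A.str.level n)
    (hy : y ∈ A.str.level m) : ⟪x, y⟫_ℂ = 0 := by
  have hx' := A.str.top_generates n hx
  clear hx
  induction hx' using Submodule.span_induction with
  | zero => simp
  | add x x' _ _ hx hx' => rw [inner_add_left, hx, hx', add_zero]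
  | smul c x _ hx => rw [inner_smul_left, hx, mul_zero]
  | mem x hx =>
    obtain ⟨w, v, a, hv, -, rfl⟩ := hx
    have hφ := 𝒱.φ_mem_level hv
    have h1 := A.invariant w (𝒱.φ v) hφ (w - n - 1) a y
    rw [𝒱.φ_φ] at h1
    rw [← h1, VOAModule.oppositeMode, LinearMap.sum_apply, Finset.sum_eq_zero, inner_zero_right]
    intro j hj
    have hj : j ≤ w := by simpa [Nat.lt_succ_iff] using hj
    have h2 := A.str.mode_level _ _ (𝒱.toVOA.L1_pow_mem hφ hj) m (2 * w - j - 2 - (w - n - 1)) y hy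
    rw [A.str.level_neg _ (by push_cast [hj]; omega), Submodule.mem_bot] at h2
    rw [LinearMap.smul_apply, h2, smul_zero]

theorem inner_weightSpace {p p' : ℤ × ℂ} (h : p ≠ p') {x y : A} (hx : x ∈ A.str.weightSpace p)
    (hy : y ∈ A.str.weightSpace p') : ⟪x, y⟫_ℂ = 0 := by
  rcases lt_trichotomy p.1 p'.1 with h1 | h1 | h1
  · rw [← inner_conj_symm, A.inner_eq_zero_of_level_lt h1 hy.1 hx.1, map_zero]
  · have h2 : p.2 + p.1 ≠ p'.2 + p'.1 := by
      rw [h1]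
      exact fun h3 => h (Prod.ext h1 (add_right_cancel h3))
    exact A.isSymmetric_L0.orthogonalFamily_eigenspaces h2 ⟨x, hx.2⟩ ⟨y, hy.2⟩
  · exact A.inner_eq_zero_of_level_lt h1 hx.1 hy.1

theorem norm_sq_sum {s : Finset (ℤ × ℂ)} {d : ℤ × ℂ → A}
    (hd : ∀ p, d p ∈ A.str.weightSpace p) : ‖∑ p ∈ s, d p‖ ^ 2 = ∑ p ∈ s, ‖d p‖ ^ 2 := by
  have h : OrthogonalFamily ℂ (fun p => A.str.weightSpace p)
      fun p => (A.str.weightSpace p).subtypeₗᵢ :=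
    fun p p' hp x y => A.inner_weightSpace hp x.2 y.2
  simpa using h.norm_sum (fun p => ⟨d p, hd p⟩) s

/-- The weight decomposition refines the decomposition into levels. -/
theorem proj_eq_zero_of_level {n : ℤ} {x : A} (hx : x ∈ A.str.level n) {p : ℤ × ℂ}
    (hp : p.1 ≠ n) : A.str.proj p x = 0 := by
  classical
  obtain ⟨s, hs, -⟩ := A.str.exists_support x
  by_cases hps : p ∈ s
  · have h1 : ⟪A.str.proj p x, x⟫_ℂ = 0 := by
      have h2 := (A.str.proj_mem p x).1
      rcases lt_or_gt_of_ne hp with h | h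
      · rw [← inner_conj_symm, A.inner_eq_zero_of_level_lt h hx h2, map_zero]
      · exact A.inner_eq_zero_of_level_lt h h2 hx
    nth_rw 2 [← A.str.sum_proj hs] at h1
    rw [inner_sum, Finset.sum_eq_single_of_mem p hps] at h1
    · exact inner_self_eq_zero.1 h1
    · intro p' _ hp'
      exact A.inner_weightSpace hp'.symm (A.str.proj_mem _ _) (A.str.proj_mem _ _)
  · exact hs p hps

/-- Every weight occurs in the top level: if `A_{0,α} = 0`, then a vector of `A_{n,α}` is
orthogonal to all generators of level `n`, whose `L₀`-eigenvalues `n + β` have `β ≠ α`. -/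
theorem weightSpace_zero_ne_bot {n : ℤ} {α : ℂ} (h : A.str.weightSpace (n, α) ≠ ⊥) :
    A.str.weightSpace (0, α) ≠ ⊥ := by
  intro h0
  refine h ((Submodule.eq_bot_iff _).2 fun x hx => ?_)
  have key : ∀ y ∈ A.str.level n, ⟪x, y⟫_ℂ = 0 := by
    intro y hy
    have hy' := A.str.top_generates n hy
    clear hy
    induction hy' using Submodule.span_induction with
    | zero => simp
    | add y y' _ _ hy hy' => rw [inner_add_right, hy, hy', add_zero]
    | smul c y _ hy => rw [inner_smul_right, hy, mul_zero]
    | mem y hy =>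
      obtain ⟨w, v, a, hv, ha, rfl⟩ := hy
      obtain ⟨s, hs, -⟩ := A.str.exists_support a
      rw [← A.str.sum_proj hs, map_sum, inner_sum]
      refine Finset.sum_eq_zero fun p _ => ?_
      by_cases hp : p.1 = 0
      · obtain ⟨p1, β⟩ := p
        obtain rfl : p1 = 0 := hp
        have hb := A.str.proj_mem (0, β) a
        by_cases hβ : β = α
        · subst hβ
          rw [h0, Submodule.mem_bot] at hb
          rw [hb, map_zero, inner_zero_right]
        · have h1 := A.str.L0_mode hv (w - n - 1) (A.str.L0_of_mem hb)
          have h2 : α + n ≠ (β + (0 : ℤ) + w - ((w - n - 1 : ℤ) : ℂ) - 1) := by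
            push_cast
            intro h3
            apply hβ
            linear_combination -h3
          exact A.isSymmetric_L0.orthogonalFamily_eigenspaces h2 ⟨x, hx.2⟩
            ⟨_, Module.End.mem_eigenspace_iff.2 h1⟩
      · rw [A.proj_eq_zero_of_level ha hp, map_zero, inner_zero_right]
  exact inner_self_eq_zero.1 (key x hx.1)

/-- Weights are nonnegative: `‖L₋₁x‖² = 2α‖x‖²` for `x` in the top level with `L₀x = αx`. -/
theorem re_weight_nonneg {α : ℂ} (h : α ∈ A.str.weights) : 0 ≤ α.re := by
  obtain ⟨n, hn⟩ := h
  obtain ⟨x, hx, hx0⟩ := Submodule.exists_mem_ne_zero_of_ne_bot (A.weightSpace_zero_ne_bot hn)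
  have h1 : VertexOperator.ncoeff (A.str.Y 𝒱.ω) 2 x = 0 := by
    have := A.str.mode_level 2 𝒱.ω 𝒱.ω_mem 0 2 x hx.1
    rwa [A.str.level_neg _ (by norm_num), Submodule.mem_bot] at this
  have h2 := A.str.virasoro 1 (-1) x
  have h3 := A.str.L0_of_mem hx
  norm_num [h1, h3] at h2
  have h4 := A.inner_L 0 x (VertexOperator.ncoeff (A.str.Y 𝒱.ω) 0 x)
  norm_num [h2, inner_smul_right, inner_self_eq_norm_sq_to_K] at h4
  have h5 := congrArg Complex.re h4
  norm_cast at h5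
  have hx1 : 0 < ‖x‖ ^ 2 := by positivity
  have h6 : ‖VertexOperator.ncoeff (A.str.Y 𝒱.ω) 0 x‖ ^ 2 = 2 * (α.re * ‖x‖ ^ 2) := by
    simpa [← Complex.ofReal_pow] using h5
  by_contra! hneg
  nlinarith [sq_nonneg ‖VertexOperator.ncoeff (A.str.Y 𝒱.ω) 0 x‖, mul_neg_of_neg_of_pos hneg hx1]

theorem norm_diag_le {f : ℤ × ℂ → ℂ} {c : ℝ} (hc : 0 ≤ c) {x : A}
    (h : ∀ p, A.str.proj p x ≠ 0 → ‖f p‖ ≤ c) : ‖A.str.diag f x‖ ≤ c * ‖x‖ := by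
  obtain ⟨s, hs, hd⟩ := A.str.exists_support x
  rw [← sq_le_sq₀ (norm_nonneg _) (by positivity), hd f]
  nth_rw 2 [← A.str.sum_proj hs]
  rw [mul_pow, A.norm_sq_sum fun p => Submodule.smul_mem _ _ (A.str.proj_mem p x),
    A.norm_sq_sum fun p => A.str.proj_mem p x, Finset.mul_sum]
  refine Finset.sum_le_sum fun p _ => ?_
  rw [norm_smul, mul_pow]
  by_cases h0 : A.str.proj p x = 0
  · simp [h0]
  · gcongr
    exact h p h0

theorem snd_mem_weights_of_proj_ne_zero {p : ℤ × ℂ} {x : A} (h : A.str.proj p x ≠ 0) :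
    p.2 ∈ A.str.weights :=
  ⟨p.1, fun hb => h (by simpa [hb] using A.str.proj_mem p x)⟩

theorem fst_nonneg_of_proj_ne_zero {p : ℤ × ℂ} {x : A} (h : A.str.proj p x ≠ 0) : 0 ≤ p.1 := by
  by_contra! hp
  have := (A.str.proj_mem p x).1
  rw [A.str.level_neg _ hp] at this
  exact h this

end UnitaryModule

/-! ### Bounded extensions to the completions -/

section Extension

variable {V : Type u} [NormedAddCommGroup V] [InnerProductSpace ℂ V] {𝒱 : UnitaryVOA V}
  {B C : UnitaryModule 𝒱}

theorem IsBoundedExtension.norm_le {f : B → C.Hilb} {W : B.Hilb →L[ℂ] C.Hilb}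
    (hW : IsBoundedExtension f W) {K : ℝ} (hK : 0 ≤ K) (h : ∀ b, ‖f b‖ ≤ K * ‖b‖) : ‖W‖ ≤ K := by
  refine W.opNorm_le_bound hK fun x => ?_
  induction x using UniformSpace.Completion.induction_on with
  | hp => exact isClosed_le (by fun_prop) (by fun_prop)
  | ih b => rw [hW b, UniformSpace.Completion.norm_coe]; exact h b

theorem exists_isBoundedExtension {f : B → C.Hilb} (hf : IsLinearMap ℂ f) {K : ℝ}
    (h : ∀ b, ‖f b‖ ≤ K * ‖b‖) : ∃ W, IsBoundedExtension f W :=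
  ⟨((hf.mk' f).mkContinuous K h).fromCompletion, fun b => by
    rw [ContinuousLinearMap.fromCompletion_apply_coe]; rfl⟩

theorem isBoundedExtension_boundedExtension {f : B → C.Hilb}
    (h : ∃ W, IsBoundedExtension f W) : IsBoundedExtension f (boundedExtension f) := by
  rw [boundedExtension, dif_pos h]
  exact h.choose_spec

/-- A diagonal operator with bounded eigenvalues extends to the completion. -/
theorem UnitaryModule.exists_diag_extension (C : UnitaryModule 𝒱) {f : ℤ × ℂ → ℂ} {c : ℝ}
    (hc : 0 ≤ c) (h : ∀ p, p.2 ∈ C.str.weights → 0 ≤ p.1 → ‖f p‖ ≤ c) :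
    ∃ D : C.Hilb →L[ℂ] C.Hilb,
      IsBoundedExtension (fun x => ((C.str.diag f x : C) : C.Hilb)) D ∧ ‖D‖ ≤ c := by
  have hb : ∀ x : C, ‖((C.str.diag f x : C) : C.Hilb)‖ ≤ c * ‖x‖ := fun x => by
    rw [UniformSpace.Completion.norm_coe]
    exact C.norm_diag_le hc fun p hp =>
      h p (C.snd_mem_weights_of_proj_ne_zero hp) (C.fst_nonneg_of_proj_ne_zero hp)
  obtain ⟨D, hD⟩ := exists_isBoundedExtension (f := fun x => ((C.str.diag f x : C) : C.Hilb))
    ⟨fun x y => by rw [map_add, UniformSpace.Completion.coe_add],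
      fun c x => by rw [map_smul, UniformSpace.Completion.coe_smul]⟩ hb
  exact ⟨D, hD, hD.norm_le hc hb⟩

end Extension

/-! ### The scaling operators -/

namespace UnitaryModule

variable {V : Type u} [NormedAddCommGroup V] [InnerProductSpace ℂ V] {𝒱 : UnitaryVOA V}
  (A : UnitaryModule 𝒱)

theorem norm_cpow_sq_le {r : ℝ} (h0 : 0 < r) (h1 : r ≤ 1) {p : ℤ × ℂ}
    (hp : p.2 ∈ A.str.weights) (hn : 0 ≤ p.1) :
    ‖(r : ℂ) ^ ((p.2 + p.1) / 2)‖ ^ 2 ≤ r ^ p.1.toNat := by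
  have hn' : ((p.1.toNat : ℝ)) = p.1 := by exact_mod_cast Int.toNat_of_nonneg hn
  rw [Complex.norm_cpow_eq_rpow_re_of_pos h0, ← Real.rpow_natCast, ← Real.rpow_mul h0.le,
    ← Real.rpow_natCast, hn']
  refine Real.rpow_le_rpow_of_exponent_ge h0 h1 ?_
  have := A.re_weight_nonneg hp
  simp
  linarith

theorem norm_qPow_sq_le {r : ℝ} (h0 : 0 < r) (h1 : r ≤ 1) {k : ℕ} {x : A}
    (hx : x ∈ A.str.level k) : ‖A.str.qPow r x‖ ^ 2 ≤ r ^ k * ‖x‖ ^ 2 := by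
  have h : ‖A.str.qPow r x‖ ≤ √(r ^ k) * ‖x‖ := by
    refine A.norm_diag_le (Real.sqrt_nonneg _) fun p hp => Real.le_sqrt_of_sq_le ?_
    have hk : p.1 = k := by
      by_contra hne
      exact hp (A.proj_eq_zero_of_level hx hne)
    simpa [hk] using A.norm_cpow_sq_le h0 h1 (A.snd_mem_weights_of_proj_ne_zero hp)
      (A.fst_nonneg_of_proj_ne_zero hp)
  calc _ ≤ (√(r ^ k) * ‖x‖) ^ 2 := by gcongr
    _ = _ := by rw [mul_pow, Real.sq_sqrt (by positivity)]

theorem norm_qPow_le {r : ℝ} (h0 : 0 < r) (h1 : r ≤ 1) (x : A) : ‖A.str.qPow r x‖ ≤ ‖x‖ := by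
  rw [← one_mul ‖x‖]
  refine A.norm_diag_le zero_le_one fun p hp => ?_
  have h := A.norm_cpow_sq_le h0 h1 (A.snd_mem_weights_of_proj_ne_zero hp)
      (A.fst_nonneg_of_proj_ne_zero hp)
  have h2 : r ^ p.1.toNat ≤ 1 := pow_le_one₀ h0.le h1
  exact (sq_le_one_iff₀ (norm_nonneg _)).1 (h.trans h2)

theorem qPow_eq_qPow_sqrt {q : ℝ} (hq : 0 < q) (x : A) :
    A.str.qPow q x = A.str.qPow (√q) (A.str.qPow (√q) x) := by
  rw [VOAModule.qPow, VOAModule.qPow, A.str.diag_diag]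
  congr 2
  ext p
  rw [Pi.mul_apply, ← Complex.mul_cpow_ofReal_nonneg (Real.sqrt_nonneg _) (Real.sqrt_nonneg _),
    ← Complex.ofReal_mul, Real.mul_self_sqrt hq.le]

/-- Diagonal operators preserve `S_hom`, although they need not preserve `S`. -/
theorem diag_mem_homPart {S : Submodule ℂ A} {f : ℤ × ℂ → ℂ} {x : A}
    (hx : x ∈ A.str.homPart S) : A.str.diag f x ∈ A.str.homPart S := by
  unfold VOAModule.homPart at hx
  induction hx using Submodule.iSup_induction' with
  | mem p x hx =>
    rw [A.str.diag_of_mem hx.2]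
    exact Submodule.smul_mem _ _ (Submodule.mem_iSup_of_mem p hx)
  | zero => simp
  | add x y _ _ hx hy => rw [map_add]; exact add_mem hx hy

theorem homPart_le (S : Submodule ℂ A) : A.str.homPart S ≤ S :=
  iSup_le fun _ => inf_le_left

/-- The Cauchy–Schwarz inequality over levels: a linear map with `‖g b‖² ≤ cₖ ‖b‖²` on level `k`
satisfies `‖g b‖² ≤ (∑ₖ cₖ) ‖b‖²`. -/
theorem norm_le_of_level {X : Type*} [NormedAddCommGroup X] [NormedSpace ℂ X] {g : A → X}
    (hg : IsLinearMap ℂ g) {c : ℕ → ℝ} {M : ℝ} (hM : 0 ≤ M) (hc : ∀ k, 0 ≤ c k)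
    (h : ∀ k : ℕ, ∀ b ∈ A.str.level k, ‖g b‖ ^ 2 ≤ c k * ‖b‖ ^ 2)
    (hs : ∀ K, ∑ k ∈ Finset.range K, c k ≤ M ^ 2) (b : A) : ‖g b‖ ≤ M * ‖b‖ := by
  classical
  obtain ⟨s, hs0, -⟩ := A.str.exists_support b
  obtain ⟨K, hK⟩ := (s.image fun p => p.1.toNat).exists_nat_subset_range
  set β : ℕ → A := fun k => ∑ p ∈ s with p.1.toNat = k, A.str.proj p b
  have hmaps : ∀ p ∈ s, p.1.toNat ∈ Finset.range K := fun p hp =>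
    hK (Finset.mem_image_of_mem _ hp)
  have hb : ∑ k ∈ Finset.range K, β k = b := by
    rw [Finset.sum_fiberwise_of_maps_to hmaps, A.str.sum_proj hs0]
  have hn : ∑ k ∈ Finset.range K, ‖β k‖ ^ 2 = ‖b‖ ^ 2 := by
    rw [← A.str.sum_proj hs0, A.norm_sq_sum (A.str.proj_mem · b),
      ← Finset.sum_fiberwise_of_maps_to hmaps]
    exact Finset.sum_congr rfl fun k _ => A.norm_sq_sum (A.str.proj_mem · b)
  have hl : ∀ k : ℕ, β k ∈ A.str.level k := fun k => Submodule.sum_mem _ fun p hp => by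
    by_cases h0 : A.str.proj p b = 0
    · rw [h0]; exact zero_mem _
    · have h1 := A.fst_nonneg_of_proj_ne_zero h0
      have h2 := (Finset.mem_filter.1 hp).2
      have h3 : p.1 = k := by omega
      exact h3 ▸ (A.str.proj_mem p b).1
  have h1 : ‖g b‖ ≤ ∑ k ∈ Finset.range K, √(c k) * ‖β k‖ := by
    have : g b = ∑ k ∈ Finset.range K, g (β k) := by
      nth_rw 1 [← hb]
      exact map_sum (hg.mk' g) _ _
    rw [this]
    refine norm_sum_le_of_le _ fun k _ => ?_
    rw [← sq_le_sq₀ (norm_nonneg _) (by positivity), mul_pow, Real.sq_sqrt (hc k)]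
    exact h k _ (hl k)
  rw [← sq_le_sq₀ (norm_nonneg _) (by positivity), mul_pow]
  calc ‖g b‖ ^ 2 ≤ (∑ k ∈ Finset.range K, √(c k) * ‖β k‖) ^ 2 := by gcongr
    _ ≤ (∑ k ∈ Finset.range K, √(c k) ^ 2) * ∑ k ∈ Finset.range K, ‖β k‖ ^ 2 :=
      Finset.sum_mul_sq_le_sq_mul_sq _ _ _
    _ = (∑ k ∈ Finset.range K, c k) * ‖b‖ ^ 2 := by
      rw [hn, Finset.sum_congr rfl fun k _ => Real.sq_sqrt (hc k)]
    _ ≤ M ^ 2 * ‖b‖ ^ 2 := by gcongr; exact hs K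

theorem eq_zero_of_ncard_weights (h : A.str.weights.ncard = 0) (x : A) : x = 0 := by
  have h0 : A.str.weights = ∅ := (Set.ncard_eq_zero A.str.finite_weights).1 h
  rw [← A.str.diag_one x, A.str.diag_congr (g := 0) (by simp [h0])]
  obtain ⟨s, -, hd⟩ := A.str.exists_support x
  simp [hd]

end UnitaryModule

/-! ### Compositions of operators -/

/-- Telescoping for compositions. The bound on the composite itself is carried along for the
induction. -/
theorem compositeOp_sub_le (n : ℕ) (H : Fin (n + 1) → Type u) [∀ i, NormedAddCommGroup (H i)]
    [∀ i, NormedSpace ℂ (H i)] (W W' : ∀ i : Fin n, H i.succ →L[ℂ] H i.castSucc) (X : Fin n → ℝ)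
    {ε : ℝ} (hW : ∀ i, ‖W i‖ ≤ X i) (hW' : ∀ i, ‖W' i‖ ≤ X i)
    (h : ∀ i, ‖W i - W' i‖ ≤ ε * X i) :
    ‖compositeOp n H W‖ ≤ ∏ i, X i ∧
      ‖compositeOp n H W - compositeOp n H W'‖ ≤ n * ε * ∏ i, X i := by
  induction n with
  | zero => exact ⟨by simpa [compositeOp] using ContinuousLinearMap.norm_id_le, by
      simp [compositeOp]⟩
  | succ n ih =>
    obtain ⟨ih1, ih2⟩ := ih (fun i => H i.succ) (fun i => W i.succ) (fun i => W' i.succ)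
      (fun i => X i.succ) (fun i => hW _) (fun i => hW' _) (fun i => h _)
    have hX0 : 0 ≤ X 0 := (norm_nonneg _).trans (hW 0)
    rw [Fin.prod_univ_succ]
    constructor
    · exact (ContinuousLinearMap.opNorm_comp_le _ _).trans
        (mul_le_mul (hW 0) ih1 (norm_nonneg _) hX0)
    · set T := compositeOp n (fun i => H i.succ) (fun i => W i.succ) with hT
      set T' := compositeOp n (fun i => H i.succ) (fun i => W' i.succ) with hT'
      have e : compositeOp (n + 1) H W - compositeOp (n + 1) H W' =
          (W 0 - W' 0).comp T + (W' 0).comp (T - T') := by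
        rw [ContinuousLinearMap.sub_comp, ContinuousLinearMap.comp_sub, sub_add_sub_cancel]
        rfl
      rw [e]
      refine (norm_add_le_of_le ((ContinuousLinearMap.opNorm_comp_le _ _).trans
        (mul_le_mul (h 0) ih1 (norm_nonneg _) ((norm_nonneg _).trans (h 0))))
        ((ContinuousLinearMap.opNorm_comp_le _ _).trans
        (mul_le_mul (hW' 0) ih2 (norm_nonneg _) hX0))).trans (le_of_eq ?_)
      push_cast
      ring

/-! ### Scaled and truncated intertwiners -/

/-- A finsum of linear maps that is pointwise finite is linear. -/
theorem isLinearMap_finsum {ι X Z : Type*} [AddCommGroup X] [Module ℂ X] [AddCommGroup Z]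
    [Module ℂ Z] {f : ι → X → Z} (hf : ∀ i, IsLinearMap ℂ (f i))
    (h : ∀ x, (Function.support fun i => f i x).Finite) :
    IsLinearMap ℂ fun x => ∑ᶠ i, f i x where
  map_add x y := by
    rw [← finsum_add_distrib (h x) (h y)]
    exact finsum_congr fun i => (hf i).map_add x y
  map_smul c x := by
    rw [smul_finsum]
    exact finsum_congr fun i => (hf i).map_smul c x

theorem isLinearMap_finsum_prop {P : Prop} {X Z : Type*} [AddCommGroup X] [Module ℂ X]
    [AddCommGroup Z] [Module ℂ Z] {f : X → Z} (hf : IsLinearMap ℂ f) :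
    IsLinearMap ℂ fun x => ∑ᶠ _ : P, f x := by
  by_cases h : P
  · simpa [h] using hf
  · simp only [h, finsum_false]
    exact (0 : X →ₗ[ℂ] Z).isLinear

theorem isLinearMap_finset_sum {ι X Z : Type*} [AddCommGroup X] [Module ℂ X] [AddCommGroup Z]
    [Module ℂ Z] {f : ι → X → Z} (hf : ∀ i, IsLinearMap ℂ (f i)) (s : Finset ι) :
    IsLinearMap ℂ fun x => ∑ i ∈ s, f i x where
  map_add x y := by
    rw [← Finset.sum_add_distrib]
    exact Finset.sum_congr rfl fun i _ => (hf i).map_add x y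
  map_smul c x := by
    rw [Finset.smul_sum]
    exact Finset.sum_congr rfl fun i _ => (hf i).map_smul c x

theorem VOAModule.finite_proj_ne_zero {V : Type u} [AddCommGroup V] [Module ℂ V] {𝒱 : VOA V}
    {A : Type u} [AddCommGroup A] [Module ℂ A] (M : VOAModule 𝒱 A) (x : A) :
    {p | M.proj p x ≠ 0}.Finite := by
  obtain ⟨s, hs, -⟩ := M.exists_support x
  exact s.finite_toSet.subset fun p hp => by_contra fun h => hp (hs p h)

namespace Intertwiner

variable {V : Type u} [NormedAddCommGroup V] [InnerProductSpace ℂ V] {𝒱 : UnitaryVOA V}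
  {A B C : UnitaryModule 𝒱} (Y : Intertwiner A B C)

theorem finite_exponents : Y.exponents.Finite := by
  refine ((A.str.finite_weights.prod (B.str.finite_weights.prod C.str.finite_weights)).image
    fun t => t.1 + t.2.1 - t.2.2).subset ?_
  rintro τ ⟨α, hα, β, hβ, γ, hγ, rfl⟩
  exact ⟨(α, β, γ), ⟨hα, hβ, hγ⟩, rfl⟩

/-- The mode `a₍ₛ₎` changes the `L₀`-eigenvalue by that of `a` minus `s + 1`. -/
theorem L0_coeff {p p' : ℤ × ℂ} {a : A} {b : B} (ha : a ∈ A.str.weightSpace p)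
    (hb : b ∈ B.str.weightSpace p') (s : ℂ) :
    VertexOperator.ncoeff (C.str.Y 𝒱.ω) 1 (Y.coeff a s b) =
      (p.2 + p.1 + (p'.2 + p'.1) - s - 1) • Y.coeff a s b := by
  have h := Y.jacobi.commutator 𝒱.ω a b s
  simp only [Y.translation, A.str.L0_of_mem ha, B.str.L0_of_mem hb, map_smul,
    sub_eq_iff_eq_add] at h
  rw [h]
  simp only [LinearMap.smul_apply, Pi.smul_apply, add_sub_cancel_left]
  module

theorem proj_coeff_eq_zero {p p' p'' : ℤ × ℂ} {a : A} {b : B} (ha : a ∈ A.str.weightSpace p)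
    (hb : b ∈ B.str.weightSpace p') {s : ℂ}
    (hs : s ≠ p.2 + p.1 + (p'.2 + p'.1) - (p''.2 + p''.1) - 1) :
    C.str.proj p'' (Y.coeff a s b) = 0 :=
  C.str.proj_eq_zero_of_L0 (Y.L0_coeff ha hb s) fun h => hs (by rw [h]; ring)

theorem isLinearMap_mode_right (r : ℤ) (τ : ℂ) (m : ℤ) (a : A) :
    IsLinearMap ℂ (Y.mode r τ m a) := by
  unfold mode
  refine isLinearMap_finsum (fun α => isLinearMap_finsum (fun k => isLinearMap_finsum
    (fun β => ?_) ?_) ?_) ?_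
  · constructor <;> intros <;> simp
  · intro b
    refine ((B.str.finite_proj_ne_zero b).image Prod.snd).subset fun β hβ => ?_
    refine ⟨(k, β), fun h => hβ ?_, rfl⟩
    simp [h]
  · intro b
    refine ((B.str.finite_proj_ne_zero b).image Prod.fst).subset fun k hk => ?_
    by_contra hne
    refine hk (finsum_eq_zero_of_forall_eq_zero fun β => ?_)
    have : B.str.proj (k, β) b = 0 := by_contra fun h => hne ⟨(k, β), h, rfl⟩
    simp [this]
  · intro b
    refine ((A.str.finite_proj_ne_zero a).image Prod.snd).subset fun α hα => ?_
    refine ⟨(r, α), fun h => hα ?_, rfl⟩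
    simp [h]

theorem isLinearMap_mode_left (r : ℤ) (τ : ℂ) (m : ℤ) (b : B) :
    IsLinearMap ℂ fun a => Y.mode r τ m a b := by
  unfold mode
  refine isLinearMap_finsum (fun α => isLinearMap_finsum (fun k => isLinearMap_finsum
    (fun β => ?_) ?_) ?_) ?_
  · constructor <;> intros <;> simp
  · intro a
    refine ((B.str.finite_proj_ne_zero b).image Prod.snd).subset fun β hβ => ?_
    refine ⟨(k, β), fun h => hβ ?_, rfl⟩
    simp [h]
  · intro a
    refine ((B.str.finite_proj_ne_zero b).image Prod.fst).subset fun k hk => ?_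
    by_contra hne
    refine hk (finsum_eq_zero_of_forall_eq_zero fun β => ?_)
    have : B.str.proj (k, β) b = 0 := by_contra fun h => hne ⟨(k, β), h, rfl⟩
    simp [this]
  · intro a
    refine ((A.str.finite_proj_ne_zero a).image Prod.snd).subset fun α hα => ?_
    refine ⟨(r, α), fun h => hα ?_, rfl⟩
    simp [h]

theorem mode_of_mem {r : ℤ} {α : ℂ} {p' : ℤ × ℂ} {a : A} {b : B}
    (ha : a ∈ A.str.weightSpace (r, α)) (hb : b ∈ B.str.weightSpace p') (r' : ℤ) (τ : ℂ) (m : ℤ) :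
    Y.mode r' τ m a b = if r' = r then
      C.str.proj (p'.1 - m, α + p'.2 - τ) (Y.coeff a (m + τ + r - 1) b) else 0 := by
  rw [mode, finsum_eq_single _ α, finsum_eq_single _ p'.1, finsum_eq_single _ p'.2]
  · rw [A.str.proj_of_mem ha, B.str.proj_of_mem hb, if_pos rfl]
    by_cases h : r' = r
    · subst h; simp
    · have h' : (r, α) ≠ (r', α) := fun h2 => h (congrArg Prod.fst h2).symm
      simp [h, h']
  · intro β hβ
    rw [B.str.proj_of_mem hb, if_neg fun h => hβ (congrArg Prod.snd h).symm]
    simp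
  · intro k hk
    refine finsum_eq_zero_of_forall_eq_zero fun β => ?_
    rw [B.str.proj_of_mem hb, if_neg fun h => hk (congrArg Prod.fst h).symm]
    simp
  · intro α' hα
    rw [A.str.proj_of_mem ha, if_neg fun h => hα (congrArg Prod.snd h).symm]
    simp

theorem mode_eq_zero {a : A} {r : ℤ} (h : ∀ α, A.str.proj (r, α) a = 0) (τ : ℂ) (m : ℤ) (b : B) :
    Y.mode r τ m a b = 0 := by
  simp [mode, h]

theorem finite_truncated_support (N : ℝ) (z : ℂ) (a : A) (b : B) :
    (Function.support fun r : ℤ => ∑ᶠ τ ∈ Y.exponents, ∑ m ∈ Finset.Icc ⌈-N⌉ ⌊N⌋,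
      z ^ (-(m : ℂ) - τ - r) • Y.mode r τ m a b).Finite := by
  refine ((A.str.finite_proj_ne_zero a).image Prod.fst).subset fun r hr => ?_
  by_contra hne
  have h : ∀ α, A.str.proj (r, α) a = 0 := fun α => by_contra fun h => hne ⟨(r, α), h, rfl⟩
  exact hr (by simp [Y.mode_eq_zero h])

theorem finite_exponents_support {X : Type*} [AddCommGroup X] (f : ℂ → X) :
    (Function.support fun τ => ∑ᶠ _ : τ ∈ Y.exponents, f τ).Finite :=
  Y.finite_exponents.subset fun τ hτ => by_contra fun h => hτ (by simp [h])

theorem isLinearMap_truncated_right (N : ℝ) (z : ℂ) (a : A) :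
    IsLinearMap ℂ (Y.truncated N z a) := by
  unfold truncated
  refine isLinearMap_finsum (fun r => isLinearMap_finsum (fun τ => isLinearMap_finsum_prop
    (isLinearMap_finset_sum (fun m => ?_) _)) ?_) fun b => Y.finite_truncated_support N z a b
  · have h := Y.isLinearMap_mode_right r τ m a
    exact ⟨fun x y => by rw [h.map_add, smul_add], fun c x => by rw [h.map_smul, smul_comm]⟩
  · exact fun b => Y.finite_exponents_support _

theorem isLinearMap_truncated_left (N : ℝ) (z : ℂ) (b : B) :
    IsLinearMap ℂ fun a => Y.truncated N z a b := by
  unfold truncated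
  refine isLinearMap_finsum (fun r => isLinearMap_finsum (fun τ => isLinearMap_finsum_prop
    (isLinearMap_finset_sum (fun m => ?_) _)) ?_) fun a => Y.finite_truncated_support N z a b
  · have h := Y.isLinearMap_mode_left r τ m b
    exact ⟨fun x y => by rw [h.map_add, smul_add], fun c x => by rw [h.map_smul, smul_comm]⟩
  · exact fun b => Y.finite_exponents_support _

theorem isLinearMap_scaledTruncated_right (N q : ℝ) (z : ℂ) (a : A) :
    IsLinearMap ℂ (Y.scaledTruncated N q z a) := by
  have h := Y.isLinearMap_truncated_right N z (A.str.qPow q a)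
  constructor <;> intros <;>
    simp [scaledTruncated, h.map_add, h.map_smul, UniformSpace.Completion.coe_add]

theorem isLinearMap_scaledTruncated_left (N q : ℝ) (z : ℂ) (b : B) :
    IsLinearMap ℂ fun a => Y.scaledTruncated N q z a b := by
  have h := Y.isLinearMap_truncated_left N z (B.str.qPow q b)
  constructor
  · intro x y
    have := h.map_add (A.str.qPow q x) (A.str.qPow q y)
    simp only [scaledTruncated, map_add, this, UniformSpace.Completion.coe_add]
  · intro c x
    have := h.map_smul c (A.str.qPow q x)
    simp only [scaledTruncated, map_smul, this, UniformSpace.Completion.coe_smul]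

theorem truncated_of_mem {r : ℤ} {α : ℂ} {p' : ℤ × ℂ} {a : A} {b : B}
    (ha : a ∈ A.str.weightSpace (r, α)) (hb : b ∈ B.str.weightSpace p') (N : ℝ) (z : ℂ) :
    Y.truncated N z a b = ∑ τ ∈ Y.finite_exponents.toFinset, ∑ m ∈ Finset.Icc ⌈-N⌉ ⌊N⌋,
      z ^ (-(m : ℂ) - τ - r) •
        C.str.proj (p'.1 - m, α + p'.2 - τ) (Y.coeff a (m + τ + r - 1) b) := by
  rw [truncated, finsum_eq_single _ r, finsum_mem_eq_finite_toFinset_sum _ Y.finite_exponents]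
  · simp only [Y.mode_of_mem ha hb, if_true]
  · intro r' hr
    simp [Y.mode_of_mem ha hb, hr]

theorem isLinearMap_scaledTerm_right (q : ℝ) (z : ℂ) (a : A) (s : ℂ) :
    IsLinearMap ℂ fun b => Y.scaledTerm q z a b s := by
  constructor <;> intro x y
  · simp [scaledTerm, UniformSpace.Completion.coe_add]
  · simp [scaledTerm, smul_comm x]

theorem isLinearMap_scaledTerm_left (q : ℝ) (z : ℂ) (b : B) (s : ℂ) :
    IsLinearMap ℂ fun a => Y.scaledTerm q z a b s := by
  constructor <;> intro x y
  · simp [scaledTerm, UniformSpace.Completion.coe_add]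
  · simp [scaledTerm, smul_comm x]

theorem isLinearMap_scaled {q : ℝ} {z : ℂ} {a : A} (h : ∀ b, Summable (Y.scaledTerm q z a b)) :
    IsLinearMap ℂ (Y.scaled q z a) where
  map_add x y := by
    simp only [scaled]
    rw [← (h x).tsum_add (h y)]
    exact tsum_congr fun s => (Y.isLinearMap_scaledTerm_right q z a s).map_add x y
  map_smul c x := by
    simp only [scaled]
    rw [← (h x).tsum_const_smul c]
    exact tsum_congr fun s => (Y.isLinearMap_scaledTerm_right q z a s).map_smul c x

theorem scaled_add_left {q : ℝ} {z : ℂ} {a a' : A} {b : B} (h : Summable (Y.scaledTerm q z a b))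
    (h' : Summable (Y.scaledTerm q z a' b)) :
    Y.scaled q z (a + a') b = Y.scaled q z a b + Y.scaled q z a' b := by
  simp only [scaled]
  rw [← h.tsum_add h']
  exact tsum_congr fun s => (Y.isLinearMap_scaledTerm_left q z b s).map_add a a'

/-- The selector of the levels `n` with `|n - k| ≤ N`, as an eigenvalue function. -/
noncomputable def band (N : ℝ) (k : ℤ) (p : ℤ × ℂ) : ℂ :=
  if k - p.1 ∈ Finset.Icc ⌈-N⌉ ⌊N⌋ then 1 else 0

/-- Cutting off a vector of `C` at the levels `k - N, …, k + N` is a finite sum of projections. The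
index `τ = α + β - γ` records the weight `γ`, and `m = k - n` records the level `n`. -/
theorem diag_band_eq_sum {α β : ℂ} (hα : α ∈ A.str.weights) (hβ : β ∈ B.str.weights) (N : ℝ)
    (k : ℤ) (x : C) :
    C.str.diag (band N k) x = ∑ τ ∈ Y.finite_exponents.toFinset,
      ∑ m ∈ Finset.Icc ⌈-N⌉ ⌊N⌋, C.str.proj (k - m, α + β - τ) x := by
  classical
  have hsum : C.str.diag (band N k) = ∑ τ ∈ Y.finite_exponents.toFinset,
      ∑ m ∈ Finset.Icc ⌈-N⌉ ⌊N⌋, C.str.proj (k - m, α + β - τ) := by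
    refine C.str.linearMap_ext fun p x hx => ?_
    by_cases hx0 : x = 0
    · simp [hx0]
    have hγ : p.2 ∈ C.str.weights := ⟨p.1, fun hb => hx0 (by simpa [hb] using hx)⟩
    rw [C.str.diag_of_mem hx, LinearMap.sum_apply,
      Finset.sum_eq_single_of_mem (α + β - p.2) (by
        rw [Set.Finite.mem_toFinset]; exact ⟨α, hα, β, hβ, p.2, hγ, rfl⟩)]
    · rw [LinearMap.sum_apply, band]
      split_ifs with h
      · rw [Finset.sum_eq_single_of_mem _ h]
        · rw [C.str.proj_of_mem hx, if_pos (by simp), one_smul]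
        · intro m _ hm
          rw [C.str.proj_of_mem hx, if_neg]
          intro h2
          have := congrArg Prod.fst h2
          simp only at this
          omega
      · rw [zero_smul, Finset.sum_eq_zero]
        intro m hm
        rw [C.str.proj_of_mem hx, if_neg]
        intro h2
        have := congrArg Prod.fst h2
        simp only at this
        exact h (by rwa [this, sub_sub_cancel])
    · intro τ _ hτ
      rw [LinearMap.sum_apply, Finset.sum_eq_zero]
      intro m _
      rw [C.str.proj_of_mem hx, if_neg]
      intro h2
      have := congrArg Prod.snd h2
      simp only at this
      exact hτ (by rw [this]; ring)
  rw [hsum]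
  simp [LinearMap.sum_apply]

/-- On homogeneous vectors the truncation is a cut-off of the untruncated series: `L₀` determines
which single term of the series contributes to a given weight space of `C`. -/
theorem scaledTruncated_of_mem {q N : ℝ} {z : ℂ} {p p' : ℤ × ℂ} {a : A} {b : B}
    (ha : a ∈ A.str.weightSpace p) (hb : b ∈ B.str.weightSpace p')
    (h : Summable (Y.scaledTerm q z a b)) {D : C.Hilb →L[ℂ] C.Hilb}
    (hD : IsBoundedExtension (fun x => ((C.str.diag (band N p'.1) x : C) : C.Hilb)) D) :
    Y.scaledTruncated N q z a b = D (Y.scaled q z a b) := by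
  by_cases ha0 : a = 0
  · subst ha0
    rw [(Y.isLinearMap_scaledTruncated_left N q z b).map_zero]
    simp [scaled, (Y.isLinearMap_scaledTerm_left q z b _).map_zero]
  by_cases hb0 : b = 0
  · subst hb0
    rw [(Y.isLinearMap_scaledTruncated_right N q z a).map_zero]
    simp [scaled, (Y.isLinearMap_scaledTerm_right q z a _).map_zero]
  have hα : p.2 ∈ A.str.weights := ⟨p.1, fun hbot => ha0 (by simpa [hbot] using ha)⟩
  have hβ : p'.2 ∈ B.str.weights := ⟨p'.1, fun hbot => hb0 (by simpa [hbot] using hb)⟩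
  have ha' : A.str.qPow q a ∈ A.str.weightSpace p := A.str.diag_mem_weightSpace ha
  have hb' : B.str.qPow q b ∈ B.str.weightSpace p' := B.str.diag_mem_weightSpace hb
  have hcomm : ∀ (p'' : ℤ × ℂ) (x : C),
      C.str.proj p'' (C.str.qPow q x) = C.str.qPow q (C.str.proj p'' x) := fun p'' x => by
    rw [VOAModule.proj, VOAModule.qPow, C.str.diag_diag, C.str.diag_diag, mul_comm]
  refine HasSum.unique (f := fun s => D (Y.scaledTerm q z a b s)) ?_ (D.hasSum h.hasSum)
  have hcoe : ∀ (t : Finset ℂ) (u : Finset ℤ) (f : ℂ → ℤ → C),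
      ((∑ τ ∈ t, ∑ m ∈ u, f τ m : C) : C.Hilb) = ∑ τ ∈ t, ∑ m ∈ u, (f τ m : C.Hilb) :=
    fun t u f => (map_sum (UniformSpace.Completion.toCompl (α := C)) _ t).trans
      (Finset.sum_congr rfl fun τ _ => map_sum (UniformSpace.Completion.toCompl (α := C)) _ u)
  have hterm : ∀ s, D (Y.scaledTerm q z a b s) = ∑ τ ∈ Y.finite_exponents.toFinset,
      ∑ m ∈ Finset.Icc ⌈-N⌉ ⌊N⌋, ((z ^ (-s - 1) • C.str.qPow q (C.str.proj
        (p'.1 - m, p.2 + p'.2 - τ) (Y.coeff (A.str.qPow q a) s (B.str.qPow q b))) : C) :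
          C.Hilb) := by
    intro s
    refine (hD _).trans ?_
    simp only [Y.diag_band_eq_sum hα hβ, map_smul, hcomm, hcoe]
  simp only [hterm]
  rw [scaledTruncated, Y.truncated_of_mem (p' := p') ha' hb']
  simp only [map_sum, map_smul, hcoe]
  refine hasSum_sum fun τ _ => hasSum_sum fun m _ => ?_
  have hs : -(m + τ + p.1 - 1) - 1 = -(m : ℂ) - τ - p.1 := by ring
  rw [← hs]
  refine hasSum_single (f := fun s => ((z ^ (-s - 1) • C.str.qPow q (C.str.proj
        (p'.1 - m, p.2 + p'.2 - τ) (Y.coeff (A.str.qPow q a) s (B.str.qPow q b))) : C) :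
          C.Hilb)) ((m : ℂ) + τ + p.1 - 1) fun s hs => ?_
  rw [Y.proj_coeff_eq_zero ha' hb']
  · simp
  · intro h
    apply hs
    rw [h]
    push_cast
    ring

end Intertwiner

/-! ### Geometric sums and the range of the parameter -/

theorem sqrt_lt_one_of_lt_min {z : ℂ} {q : ℝ} (hq : √q < min (‖z‖ ^ 2) (1 / ‖z‖ ^ 2)) : √q < 1 := by
  refine hq.trans_le ?_
  by_cases h : ‖z‖ ^ 2 ≤ 1
  · exact (min_le_left _ _).trans h
  · refine (min_le_right _ _).trans ?_
    rw [one_div]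
    exact inv_le_one_of_one_le₀ (not_le.1 h).le

theorem lt_min_of_sqrt_lt {z : ℂ} {q : ℝ} (h0 : 0 < q)
    (hq : √q < min (‖z‖ ^ 2) (1 / ‖z‖ ^ 2)) : q < min (‖z‖ ^ 2) (1 / ‖z‖ ^ 2) := by
  refine lt_of_le_of_lt ?_ hq
  nth_rw 1 [← Real.mul_self_sqrt h0.le]
  exact mul_le_of_le_one_left (Real.sqrt_nonneg _) (sqrt_lt_one_of_lt_min hq).le

theorem geom_sum_le {r : ℝ} (h0 : 0 ≤ r) (h1 : r < 1) (K : ℕ) :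
    ∑ k ∈ Finset.range K, r ^ k ≤ 1 / (1 - r) := by
  rw [one_div, ← tsum_geometric_of_lt_one h0 h1]
  exact (summable_geometric_of_lt_one h0 h1).sum_le_tsum _ fun _ _ => by positivity

theorem sum_shifted_geom_le {r : ℝ} (h0 : 0 < r) (h1 : r < 1) (m K : ℕ) :
    ∑ k ∈ Finset.range K, (r ^ k + if m ≤ k then r ^ (k - m) else 0) ≤ 2 / (1 - r) := by
  have h2 : ∑ k ∈ Finset.range K, (if m ≤ k then r ^ (k - m) else 0) ≤ 1 / (1 - r) := by
    calc _ ≤ ∑ k ∈ Finset.range (m + K), (if m ≤ k then r ^ (k - m) else 0) := by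
          refine Finset.sum_le_sum_of_subset_of_nonneg (Finset.range_mono (by omega)) ?_
          intro k _ _
          split_ifs <;> positivity
      _ = ∑ j ∈ Finset.range K, r ^ j := by
          rw [Finset.sum_range_add, Finset.sum_eq_zero, zero_add]
          · simp
          · intro k hk
            rw [if_neg (by simpa using hk)]
      _ ≤ _ := geom_sum_le h0.le h1 K
  rw [Finset.sum_add_distrib]
  calc _ ≤ 1 / (1 - r) + 1 / (1 - r) := add_le_add (geom_sum_le h0.le h1 K) h2
    _ = _ := by ring

/-! ### Bounds for a single intertwiner -/

namespace Intertwiner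

variable {V : Type u} [NormedAddCommGroup V] [InnerProductSpace ℂ V] {𝒱 : UnitaryVOA V}
  {A B C : UnitaryModule 𝒱} {Y : Intertwiner A B C} {S : Submodule ℂ A} {ϑ : ℝ → ℂ → ℝ}

theorem IsBoundednessParameter.norm_scaled_le (h : Y.IsBoundednessParameter S ϑ) {z : ℂ} {q : ℝ}
    (hz : z ≠ 0) (hq : 0 < q) (hqz : q < min (‖z‖ ^ 2) (1 / ‖z‖ ^ 2)) {a : A} (ha : a ∈ S)
    (b : B) : ‖Y.scaled q z a b‖ ≤ ϑ q z * ‖a‖ * ‖b‖ := by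
  obtain ⟨h0, h1⟩ := h z q hz hq hqz
  have h2 := (h1 a ha b).2
  rw [← sq_le_sq₀ (norm_nonneg _) (by positivity), mul_pow, mul_pow]
  rwa [form, inner_self_eq_norm_sq_to_K, ← RCLike.ofReal_pow, RCLike.ofReal_eq_complex_ofReal,
    Complex.ofReal_re] at h2

/-- The factorization `W_q(a, z) = q^{L₀/4} W_{√q}(q^{L₀/4} a, z) q^{L₀/4}`. -/
theorem scaled_eq_sqrt {q : ℝ} (hq : 0 < q) {z : ℂ} {a : A} {b : B}
    (h : Summable (Y.scaledTerm (√q) z (A.str.qPow (√q) a) (B.str.qPow (√q) b)))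
    {Q : C.Hilb →L[ℂ] C.Hilb}
    (hQ : IsBoundedExtension (fun x => ((C.str.qPow (√q) x : C) : C.Hilb)) Q) :
    Y.scaled q z a b = Q (Y.scaled (√q) z (A.str.qPow (√q) a) (B.str.qPow (√q) b)) := by
  rw [scaled, scaled, Q.map_tsum h]
  refine tsum_congr fun s => ?_
  refine Eq.trans ?_ (hQ _).symm
  rw [scaledTerm, A.qPow_eq_qPow_sqrt hq, B.qPow_eq_qPow_sqrt hq, C.qPow_eq_qPow_sqrt hq]
  simp only [map_smul]

theorem scaledTruncated_eq (hϑ : Y.IsBoundednessParameter S ϑ) {z : ℂ} {q : ℝ} (hz : z ≠ 0)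
    (hq : 0 < q) (hqz : q < min (‖z‖ ^ 2) (1 / ‖z‖ ^ 2)) {a : A} (ha : a ∈ A.str.homPart S)
    {k : ℤ} {b : B} (hb : b ∈ B.str.level k) (N : ℝ) {D : C.Hilb →L[ℂ] C.Hilb}
    (hD : IsBoundedExtension (fun x => ((C.str.diag (band N k) x : C) : C.Hilb)) D) :
    Y.scaledTruncated N q z a b = D (Y.scaled q z a b) := by
  have hsum : ∀ a ∈ S, ∀ b, Summable (Y.scaledTerm q z a b) := fun a ha b =>
    ((hϑ z q hz hq hqz).2 a ha b).1
  have hS := A.homPart_le S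
  unfold VOAModule.homPart at ha hS
  induction ha using Submodule.iSup_induction' with
  | mem p a ha =>
    have h1 := Y.isLinearMap_scaledTruncated_right N q z a
    have h2 := Y.isLinearMap_scaled (hsum a ha.1)
    obtain ⟨s, hs, -⟩ := B.str.exists_support b
    rw [← B.str.sum_proj hs]
    have e1 := map_sum (h1.mk' _) (fun p => B.str.proj p b) s
    have e2 := map_sum (h2.mk' _) (fun p => B.str.proj p b) s
    simp only [IsLinearMap.mk'_apply] at e1 e2
    rw [e1, e2, map_sum]
    refine Finset.sum_congr rfl fun p' _ => ?_
    by_cases hp : p'.1 = k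
    · exact Y.scaledTruncated_of_mem ha.2 (B.str.proj_mem p' b) (hsum a ha.1 _) (hp ▸ hD)
    · rw [B.proj_eq_zero_of_level hb hp, h1.map_zero, h2.map_zero, map_zero]
  | zero =>
    rw [(Y.isLinearMap_scaledTruncated_left N q z b).map_zero]
    simp [scaled, (Y.isLinearMap_scaledTerm_left q z b _).map_zero]
  | add a a' ha ha' h h' =>
    rw [(Y.isLinearMap_scaledTruncated_left N q z b).map_add, h, h',
      Y.scaled_add_left (hsum a (hS ha) b) (hsum a' (hS ha') b), map_add]

/-- On level `k`, a cut-off of `W_q(a, z)` by an eigenvalue function `f` is controlled by the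
largest value of `|f|² q^{(n+k)/2}` over the levels `n`. -/
theorem norm_diag_scaled_sq_le (hϑ : Y.IsBoundednessParameter S ϑ) {z : ℂ} {q : ℝ} (hz : z ≠ 0)
    (hq : 0 < q) (hqz : √q < min (‖z‖ ^ 2) (1 / ‖z‖ ^ 2)) {a : A} (ha : a ∈ A.str.homPart S)
    {k : ℕ} {b : B} (hb : b ∈ B.str.level k) {f : ℤ × ℂ → ℂ} {c : ℝ} (hc : 0 ≤ c)
    (hf : ∀ p, 0 ≤ p.1 → ‖f p‖ ^ 2 * √q ^ (p.1.toNat + k) ≤ c) {D : C.Hilb →L[ℂ] C.Hilb}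
    (hD : IsBoundedExtension (fun x => ((C.str.diag f x : C) : C.Hilb)) D) :
    ‖D (Y.scaled q z a b)‖ ^ 2 ≤ c * (ϑ (√q) z * ‖a‖) ^ 2 * ‖b‖ ^ 2 := by
  have hr : 0 < √q := Real.sqrt_pos.2 hq
  have hr1 := (sqrt_lt_one_of_lt_min hqz).le
  set r := √q with hrdef
  have ha' : A.str.qPow r a ∈ S := A.homPart_le S (A.diag_mem_homPart ha)
  obtain ⟨hϑ0, hϑ1⟩ := hϑ z r hz hr hqz
  obtain ⟨Q, hQ, -⟩ := C.exists_diag_extension (f := fun p => (r : ℂ) ^ ((p.2 + p.1) / 2))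
    zero_le_one fun p hp hn => by
      have h := C.norm_cpow_sq_le hr hr1 hp hn
      exact (sq_le_one_iff₀ (norm_nonneg _)).1 (h.trans (pow_le_one₀ hr.le hr1))
  obtain ⟨E, hE, hEn⟩ := C.exists_diag_extension
    (f := f * fun p : ℤ × ℂ => (r : ℂ) ^ ((p.2 + p.1) / 2)) (Real.sqrt_nonneg (c / r ^ k))
    fun p hp hn => by
      refine Real.le_sqrt_of_sq_le ?_
      rw [le_div_iff₀ (by positivity), Pi.mul_apply, norm_mul, mul_pow]
      refine le_trans ?_ (hf p hn)
      rw [pow_add, ← mul_assoc]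
      gcongr
      exact C.norm_cpow_sq_le hr hr1 hp hn
  have hDQ : D.comp Q = E := by
    ext x
    induction x using UniformSpace.Completion.induction_on with
    | hp => exact isClosed_eq (by fun_prop) (by fun_prop)
    | ih x =>
      rw [ContinuousLinearMap.comp_apply, hQ x, hE x]
      simp only [← C.str.diag_diag]
      exact hD _
  have h1 : D (Y.scaled q z a b) = E (Y.scaled r z (A.str.qPow r a) (B.str.qPow r b)) := by
    rw [scaled_eq_sqrt hq (hϑ1 _ ha' _).1 hQ, ← hDQ]
    rfl
  have h2 := hϑ.norm_scaled_le hz hr hqz ha' (B.str.qPow r b)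
  have h3 := B.norm_qPow_sq_le hr hr1 hb
  have h4 := A.norm_qPow_le hr hr1 a
  rw [h1]
  calc ‖E (Y.scaled r z (A.str.qPow r a) (B.str.qPow r b))‖ ^ 2
      ≤ (√(c / r ^ k) * (ϑ r z * ‖a‖ * ‖B.str.qPow r b‖)) ^ 2 := by
        gcongr
        refine (E.le_of_opNorm_le hEn _).trans ?_
        gcongr
        exact h2.trans (by gcongr)
    _ = c / r ^ k * ((ϑ r z * ‖a‖) ^ 2 * ‖B.str.qPow r b‖ ^ 2) := by
        rw [mul_pow, Real.sq_sqrt (by positivity), mul_pow _ ‖B.str.qPow r b‖]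
    _ ≤ c / r ^ k * ((ϑ r z * ‖a‖) ^ 2 * (r ^ k * ‖b‖ ^ 2)) := by gcongr
    _ = c * (ϑ r z * ‖a‖) ^ 2 * ‖b‖ ^ 2 := by field_simp

theorem norm_band_le (N : ℝ) (k : ℤ) (p : ℤ × ℂ) : ‖band N k p‖ ≤ 1 := by
  unfold band
  split_ifs <;> simp

/-- The decay outside the band: if `|n - k| > N`, then `n + k ≥ N + k` for `k < N`, and
`n + k ≥ N + (k - N)` otherwise. -/
theorem norm_one_sub_band_le {r : ℝ} (h0 : 0 < r) (h1 : r < 1) (N : ℝ) (k : ℕ)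
    {p : ℤ × ℂ} (hp : 0 ≤ p.1) :
    ‖(1 - band N k) p‖ ^ 2 * r ^ (p.1.toNat + k) ≤
      r ^ N * (r ^ k + if ⌈N⌉₊ ≤ k then r ^ (k - ⌈N⌉₊) else 0) := by
  have hpos : 0 ≤ r ^ N * (r ^ k + if ⌈N⌉₊ ≤ k then r ^ (k - ⌈N⌉₊) else 0) := by
    split_ifs <;> positivity
  by_cases h : (k : ℤ) - p.1 ∈ Finset.Icc ⌈-N⌉ ⌊N⌋
  · simpa [band, h] using hpos
  · have hlt : N < |(k : ℝ) - p.1| := by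
      by_contra! hle
      apply h
      rw [Finset.mem_Icc, Int.ceil_le, Int.le_floor]
      push_cast
      exact ⟨neg_le_of_abs_le hle, le_of_abs_le hle⟩
    have hceil : (⌈N⌉₊ : ℤ) ≤ |(k : ℤ) - p.1| := by
      have h2 : (0 : ℤ) ≤ |(k : ℤ) - p.1| := abs_nonneg _
      lift |(k : ℤ) - p.1| to ℕ using h2 with j hj
      have : (j : ℝ) = |(k : ℝ) - p.1| := by exact_mod_cast congrArg (Int.cast (R := ℝ)) hj
      rw [← this] at hlt
      exact_mod_cast Nat.ceil_le.2 hlt.le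
    have hrN : r ^ ⌈N⌉₊ ≤ r ^ N := by
      rw [← Real.rpow_natCast]
      exact Real.rpow_le_rpow_of_exponent_ge h0 h1.le (Nat.le_ceil N)
    have e : ‖(1 - band N k) p‖ = 1 := by simp [band, h]
    rw [e, one_pow, one_mul]
    have hr' : ∀ m, ⌈N⌉₊ + m ≤ p.1.toNat + k → r ^ (p.1.toNat + k) ≤ r ^ N * r ^ m := by
      intro m hm
      calc r ^ (p.1.toNat + k) ≤ r ^ (⌈N⌉₊ + m) := pow_le_pow_of_le_one h0.le h1.le hm
        _ = r ^ ⌈N⌉₊ * r ^ m := pow_add _ _ _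
        _ ≤ _ := by gcongr
    split_ifs with hk
    · refine (hr' (k - ⌈N⌉₊) (by omega)).trans ?_
      gcongr
      exact le_add_of_nonneg_left (by positivity)
    · rw [add_zero]
      refine hr' k ?_
      rw [le_abs] at hceil
      omega

/-- The operator bounds for a single intertwiner: for `W_q(a, z)`, for its truncation, and for their
difference. -/
theorem scaled_bounds (hϑ : Y.IsBoundednessParameter S ϑ) {z : ℂ} {q : ℝ} (hz : z ≠ 0)
    (hq : 0 < q) (hqz : √q < min (‖z‖ ^ 2) (1 / ‖z‖ ^ 2)) (N : ℝ) {a : A}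
    (ha : a ∈ A.str.homPart S) :
    IsLinearMap ℂ (Y.scaled q z a) ∧ ∀ b : B,
      ‖Y.scaled q z a b‖ ≤ ϑ (√q) z * ‖a‖ / (1 - √q) * ‖b‖ ∧
      ‖Y.scaledTruncated N q z a b‖ ≤ ϑ (√q) z * ‖a‖ / (1 - √q) * ‖b‖ ∧
      ‖Y.scaled q z a b - Y.scaledTruncated N q z a b‖ ≤
        2 * q ^ (N / 4) * (ϑ (√q) z * ‖a‖ / (1 - √q)) * ‖b‖ := by
  have hr : 0 < √q := Real.sqrt_pos.2 hq
  have hr1 := sqrt_lt_one_of_lt_min hqz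
  have hq' := lt_min_of_sqrt_lt hq hqz
  have hpow : (q ^ (N / 4)) ^ 2 = √q ^ N := by
    rw [Real.sqrt_eq_rpow, ← Real.rpow_natCast, ← Real.rpow_mul hq.le, ← Real.rpow_mul hq.le]
    congr 1
    push_cast
    ring
  have hlin := Y.isLinearMap_scaled fun b => ((hϑ z q hz hq hq').2 a (A.homPart_le S ha) b).1
  have hlinT := Y.isLinearMap_scaledTruncated_right N q z a
  have hϑ0 : 0 ≤ ϑ (√q) z := (hϑ z _ hz hr hqz).1
  have hband : ∀ k : ℤ, ∃ D : C.Hilb →L[ℂ] C.Hilb,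
      IsBoundedExtension (fun x => ((C.str.diag (band N k) x : C) : C.Hilb)) D := fun k => by
    obtain ⟨D, hD, -⟩ := C.exists_diag_extension (f := band N k) zero_le_one
      fun p _ _ => norm_band_le N k p
    exact ⟨D, hD⟩
  set r := √q
  set t := ϑ r z * ‖a‖
  have ht : 0 ≤ t := by positivity
  have h1r : 0 < 1 - r := by linarith
  have hinv : 1 / (1 - r) ≤ (1 / (1 - r)) ^ 2 := by
    have : 1 ≤ 1 / (1 - r) := by rw [le_div_iff₀ h1r]; linarith
    nlinarith
  have hsum : ∀ K, ∑ k ∈ Finset.range K, r ^ k * t ^ 2 ≤ (t / (1 - r)) ^ 2 := fun K => by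
    rw [← Finset.sum_mul]
    calc _ ≤ (1 / (1 - r)) ^ 2 * t ^ 2 := by
          gcongr
          exact (geom_sum_le hr.le hr1 K).trans hinv
      _ = _ := by ring
  have hid : IsBoundedExtension (fun x => ((C.str.diag 1 x : C) : C.Hilb))
      (ContinuousLinearMap.id ℂ C.Hilb) := fun x => by simp [C.str.diag_one]
  refine ⟨hlin, fun b => ⟨?_, ?_, ?_⟩⟩
  · refine B.norm_le_of_level hlin (by positivity) (c := fun k => r ^ k * t ^ 2)
      (fun k => by positivity) (fun k b hb => ?_) hsum b
    refine norm_diag_scaled_sq_le hϑ hz hq hqz ha hb (by positivity) (fun p _ => ?_) hid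
    simpa using pow_le_pow_of_le_one hr.le hr1.le (Nat.le_add_left _ _)
  · refine B.norm_le_of_level hlinT (by positivity) (c := fun k => r ^ k * t ^ 2)
      (fun k => by positivity) (fun k b hb => ?_) hsum b
    obtain ⟨D, hD⟩ := hband k
    rw [scaledTruncated_eq hϑ hz hq hq' ha hb N hD]
    refine norm_diag_scaled_sq_le hϑ hz hq hqz ha hb (by positivity) (fun p _ => ?_) hD
    rw [← one_mul (r ^ k)]
    gcongr ?_ * ?_
    · exact pow_le_one₀ (norm_nonneg _) (norm_band_le N k p)
    · exact pow_le_pow_of_le_one hr.le hr1.le (Nat.le_add_left _ _)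
  · have hlinS : IsLinearMap ℂ fun b => Y.scaled q z a b - Y.scaledTruncated N q z a b :=
      (hlin.mk' _ - hlinT.mk' _).isLinear
    have hc : ∀ k, 0 ≤ r ^ N * (r ^ k + if ⌈N⌉₊ ≤ k then r ^ (k - ⌈N⌉₊) else 0) := fun k => by
      split_ifs <;> positivity
    refine B.norm_le_of_level hlinS (by positivity)
      (c := fun k => r ^ N * (r ^ k + if ⌈N⌉₊ ≤ k then r ^ (k - ⌈N⌉₊) else 0) * t ^ 2)
      (fun k => mul_nonneg (hc k) (by positivity)) (fun k b hb => ?_) (fun K => ?_) b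
    · obtain ⟨D, hD⟩ := hband k
      rw [scaledTruncated_eq hϑ hz hq hq' ha hb N hD]
      have hD' : IsBoundedExtension (fun x => ((C.str.diag (1 - band N k) x : C) : C.Hilb))
          (ContinuousLinearMap.id ℂ C.Hilb - D) := fun x => by
        simp only [C.str.diag_sub, C.str.diag_one, UniformSpace.Completion.coe_sub,
          sub_apply, hD x, ContinuousLinearMap.id_apply]
      exact norm_diag_scaled_sq_le hϑ hz hq hqz ha hb (hc k)
        (fun p hp => norm_one_sub_band_le hr hr1 N k hp) hD'
    · rw [← Finset.sum_mul, ← Finset.mul_sum]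
      calc _ ≤ r ^ N * (2 / (1 - r)) * t ^ 2 := by
            gcongr
            exact sum_shifted_geom_le hr hr1 _ K
        _ = r ^ N * t ^ 2 * 2 * (1 / (1 - r)) := by ring
        _ ≤ r ^ N * t ^ 2 * 4 * (1 / (1 - r)) ^ 2 := by gcongr; norm_num
        _ = _ := by rw [← hpow]; ring

end Intertwiner

/-! ### Transfer operators -/

theorem mainTheorem4 {V : Type u} [NormedAddCommGroup V] [InnerProductSpace ℂ V]
    (𝒱 : UnitaryVOA V) :
    ∃ κ : UnitaryModule 𝒱 → UnitaryModule 𝒱 → UnitaryModule 𝒱 → ℝ,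
      (∀ A B C, 0 < κ A B C) ∧
      ∀ (n : ℕ) (A : Fin n → UnitaryModule 𝒱) (B : Fin (n + 1) → UnitaryModule 𝒱)
        (Y : ∀ i, Intertwiner (A i) (B i.succ) (B i.castSucc))
        (S : ∀ i, Submodule ℂ (A i)) (ϑ : Fin n → ℝ → ℂ → ℝ)
        (z : ℂ) (q N : ℝ) (a : ∀ i, A i),
        1 ≤ n →
        (∀ i, (Y i).IsBoundednessParameter (S i) (ϑ i)) →
        z ≠ 0 → 0 < q → Real.sqrt q < min (‖z‖ ^ 2) (1 / ‖z‖ ^ 2) → 0 ≤ N →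
        (∀ i, a i ∈ (A i).str.homPart (S i)) →
        (∀ i, ∃ W, IsBoundedExtension ((Y i).scaled q z (a i)) W) ∧
        (∀ i, ∃ W, IsBoundedExtension ((Y i).scaledTruncated N q z (a i)) W) ∧
        ‖transferOp Y q z a - truncatedTransferOp Y N q z a‖ ≤
          q ^ (N / 4) *
            (n * (⨆ i, κ (A i) (B i.succ) (B i.castSucc)) *
              (⨆ i, Real.sqrt ((B i.succ).str.weights.ncard : ℝ) * ϑ i (Real.sqrt q) z /
                (1 - Real.sqrt q)) ^ n) *
            ∏ i, ‖a i‖ := by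

  refine ⟨fun _ _ _ => 2, fun _ _ _ => two_pos, ?_⟩
  intro n A B Y S ϑ z q N a hn hϑ hz hq hqz _ ha
  have hb := fun i => Intertwiner.scaled_bounds (hϑ i) hz hq hqz N (ha i)
  have hW : ∀ i, ∃ W, IsBoundedExtension ((Y i).scaled q z (a i)) W := fun i =>
    exists_isBoundedExtension (hb i).1 fun b => ((hb i).2 b).1
  have hW' : ∀ i, ∃ W, IsBoundedExtension ((Y i).scaledTruncated N q z (a i)) W := fun i =>
    exists_isBoundedExtension ((Y i).isLinearMap_scaledTruncated_right N q z (a i))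
      fun b => ((hb i).2 b).2.1
  refine ⟨hW, hW', ?_⟩
  have hr1 : 0 < 1 - √q := sub_pos.2 (sqrt_lt_one_of_lt_min hqz)
  have hϑ0 : ∀ i, 0 ≤ ϑ i (√q) z := fun i => (hϑ i z _ hz (Real.sqrt_pos.2 hq) hqz).1
  set X : Fin n → ℝ := fun i => √((B i.succ).str.weights.ncard : ℝ) * ϑ i (√q) z / (1 - √q)
  have hX : ∀ i, 0 ≤ X i := fun i =>
    div_nonneg (mul_nonneg (Real.sqrt_nonneg _) (hϑ0 i)) hr1.le
  -- A module without weights is zero, so the factor `√|I_B| = 0` does no harm there.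
  have hle : ∀ i (c : ℝ), 0 ≤ c → ∀ b : B i.succ,
      c * (ϑ i (√q) z * ‖a i‖ / (1 - √q)) * ‖b‖ ≤ c * (X i * ‖a i‖) * ‖b‖ := by
    intro i c hc b
    by_cases h0 : (B i.succ).str.weights.ncard = 0
    · simp [(B i.succ).eq_zero_of_ncard_weights h0 b]
    · have h1 : 1 ≤ √((B i.succ).str.weights.ncard : ℝ) :=
        Real.one_le_sqrt.2 (by exact_mod_cast Nat.one_le_iff_ne_zero.2 h0)
      have h2 : ϑ i (√q) z * ‖a i‖ / (1 - √q) ≤ X i * ‖a i‖ := by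
        rw [div_mul_eq_mul_div]
        gcongr
        exact le_mul_of_one_le_left (hϑ0 i) h1
      gcongr
  have hext := fun i => isBoundedExtension_boundedExtension (hW i)
  have hext' := fun i => isBoundedExtension_boundedExtension (hW' i)
  have hnn : ∀ i, 0 ≤ X i * ‖a i‖ := fun i => mul_nonneg (hX i) (norm_nonneg _)
  have key := (compositeOp_sub_le n (fun i => (B i).Hilb)
    (fun i => boundedExtension ((Y i).scaled q z (a i)))
    (fun i => boundedExtension ((Y i).scaledTruncated N q z (a i)))
    (fun i => X i * ‖a i‖) (ε := 2 * q ^ (N / 4))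
    (fun i => (hext i).norm_le (hnn i) fun b => ((hb i).2 b).1.trans (by
      simpa using hle i 1 zero_le_one b))
    (fun i => (hext' i).norm_le (hnn i) fun b => ((hb i).2 b).2.1.trans (by
      simpa using hle i 1 zero_le_one b))
    (fun i => IsBoundedExtension.norm_le (f := fun b =>
        (Y i).scaled q z (a i) b - (Y i).scaledTruncated N q z (a i) b)
      (fun b => by rw [sub_apply, hext i b, hext' i b])
      (mul_nonneg (by positivity) (hnn i))
      fun b => ((hb i).2 b).2.2.trans (hle i _ (by positivity) b))).2
  refine key.trans ?_
  have : Nonempty (Fin n) := ⟨⟨0, hn⟩⟩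
  have hprod : ∏ i, X i ≤ (⨆ i, X i) ^ n := by
    refine (Finset.prod_le_prod (fun i _ => hX i) fun i _ =>
      le_ciSup (Set.finite_range X).bddAbove i).trans (by simp)
  rw [Finset.prod_mul_distrib, ciSup_const]
  calc n * (2 * q ^ (N / 4)) * ((∏ i, X i) * ∏ i, ‖a i‖)
      ≤ n * (2 * q ^ (N / 4)) * ((⨆ i, X i) ^ n * ∏ i, ‖a i‖) := by gcongr
    _ = q ^ (N / 4) * (n * 2 * (⨆ i, X i) ^ n) * ∏ i, ‖a i‖ := by ring
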